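/- **Setting.** There are $P$ agents; agent $p$ holds data $x_{p,1},\dots,x_{p,N_p}$ and has the risk $J_p(w)=\frac1{N_p}\sum_{n}Q_p(w;x_{p,n})$, $w\in\mathbb R^M$. Let $w^o$ minimize $\frac1P\sum_pJ_p$ and let $w_p^o$ minimize $J_p$. Let $A_0,A_1,A_2$ be left-stochastic $P\times P$ matrices, $A_j=[a_{j,mp}]$ (nonnegative entries, columns adding up to one), such that $A_1A_0A_2$ is primitive, and let $q$ be its Perron eigenvector ($A_1A_0A_2q=q$, $q_p>0$, $\sum_pq_p=1$). Put $r=A_2q$ and suppose that $w^o$ also minimizes $\sum_pr_pJ_p$ (this is automatic if $r_p=1/P$ for all $p$, in particular if $A_0,A_1,A_2$ are doubly stochastic). For a step-size $\mu>0$ consider, for $i\ge1$, $$\phi_{p,i-1}=\sum_ma_{1,mp}(w_{m,i-1}+g_{1,mp,i}),$$ $$\psi_{p,i}=\sum_ma_{0,mp}(\phi_{m,i-1}+g_{0,mp,i})-\mu\,\widehat{\nabla J_p}(\phi_{p,i-1}),$$ $$w_{p,i}=\sum_ma_{2,mp}(\psi_{m,i}+g_{2,mp,i}),$$ with square-integrable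 random initial models $w_{p,0}$ and random gradient approximations $\widehat{\nabla J_p}$. Let $\mathcal F_{i-1}$ be the $\sigma$-algebra generated by the models $w_{p,j}$, $1\le p\le P$, $0\le j\le i-1$. **Assumptions.** (1) Every $J_p$ is $\nu$-strongly convex ($\nu>0$); every $Q_p(\cdot;x_{p,n})$ is convex and twice differentiable, with $\delta$-Lipschitz gradient. (2) $\|w^o-w_p^o\|\le\xi$ for all $p$. (3) The noises $g_{j,mp,i}$ are independent of each other, those of iteration $i$ are independent of $\mathcal F_{i-1}$, and each coordinate of each of them has the Laplace distribution with mean zero and variance $\sigma_g^2>0$. (4) The gradient noise $s_{p,i}=\widehat{\nabla J_p}(\phi_{p,i-1})-\nabla J_p(\phi_{p,i-1})$ is square-integrable, with $\mathbb E[s_{p,i}\mid\mathcal F_{i-1}]=0$ and $\mathbb E[\|s_{p,i}\|^2\mid\mathcal F_{i-1}]\le\mathbb E[\beta_{s,p}^2\|w^o-\phi_{p,i-1}\|^2+\sigma_{s,p}^2\mid\mathcal F_{i-1}]$. Put $\sigma_s^2=\sum_p\sigma_{s,p}^2$ and $\|\widetilde{\mathcal W}_i\|^2=\sum_p\|w^o-w_{p,i}\|^2$.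 **Theorem.** There are $\mu_0>0$ and $C\ge0$, depending only on $P$, $M$, $A_0,A_1,A_2$, $\nu$, $\delta$, $\xi$ and $(\beta_{s,p})_p$, such that for every $0<\mu<\mu_0$ there is $\gamma\in[0,1)$, depending only on $\mu$ and these parameters, with the following property. For all data, losses, initial models, gradient approximations and noises as above, $\mathbb E\|\widetilde{\mathcal W}_i\|^2<\infty$ and $$\mathbb E\|\widetilde{\mathcal W}_i\|^2\le C\gamma^i\,\mathbb E\|\widetilde{\mathcal W}_0\|^2+C\mu\,\sigma_s^2+C\mu+(C\mu^{-1}+C\mu)\,\sigma_g^2\qquad(i\ge0),$$ so the recursion converges exponentially fast to a neighbourhood of $w^o$, and $$\limsup_{i\to\infty}\mathbb E\|\widetilde{\mathcal W}_i\|^2\le C\mu\,\sigma_s^2+C\mu+(C\mu^{-1}+C\mu)\,\sigma_g^2 .$$ -/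

import Mathlib

open MeasureTheory ProbabilityTheory Filter
open scoped BigOperators Topology Matrix

/-- The Euclidean space `ℝ^M` in which the models live. -/
abbrev Vec (M : ℕ) : Type := EuclideanSpace ℝ (Fin M)

noncomputable section

/-! ### The learning problem -/

/-- The data of a network learning problem with `P` agents and models in `ℝ^M`: agent `p` holds
`N p` data points `x p n` in a data space `X`, and uses the loss `Q p w x`. -/
structure LearningProblem (P M : ℕ) (X : Type*) where
  N : Fin P → ℕ
  x : (p : Fin P) → Fin (N p) → X
  Q : Fin P → Vec M → X → ℝ

namespace LearningProblem

variable {P M : ℕ} {X : Type*} (L : LearningProblem P M X)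

/-- The empirical risk `J_p(w) = (1 / N_p) ∑_n Q_p(w; x_{p,n})` of agent `p`. -/
def risk (p : Fin P) (w : Vec M) : ℝ :=
  (1 / (L.N p : ℝ)) * ∑ n, L.Q p w (L.x p n)

/-- The aggregate cost `(1 / P) ∑_p J_p(w)`. -/
def aggregate (w : Vec M) : ℝ :=
  (1 / (P : ℝ)) * ∑ p, L.risk p w

/-- The weighted aggregate cost `∑_p r_p J_p(w)`. -/
def weightedAggregate (r : Fin P → ℝ) (w : Vec M) : ℝ :=
  ∑ p, r p * L.risk p w

/-- Convexity and smoothness: the risks are `ν`-strongly convex; the losses at the data points are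
convex, twice differentiable, and have `δ`-Lipschitz gradients. -/
structure ConvexSmooth (ν δ : ℝ) : Prop where
  strongly_convex : ∀ p (w₁ w₂ : Vec M),
    L.risk p w₁ + inner ℝ (gradient (L.risk p) w₁) (w₂ - w₁) + ν / 2 * ‖w₂ - w₁‖ ^ 2
      ≤ L.risk p w₂
  convex : ∀ p n (w₁ w₂ : Vec M),
    L.Q p w₁ (L.x p n) + inner ℝ (gradient (fun w => L.Q p w (L.x p n)) w₁) (w₂ - w₁)
      ≤ L.Q p w₂ (L.x p n)
  differentiable : ∀ p n, Differentiable ℝ (fun w => L.Q p w (L.x p n))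
  twice_differentiable : ∀ p n,
    Differentiable ℝ (gradient (fun w => L.Q p w (L.x p n)))
  lipschitz : ∀ p n (w₁ w₂ : Vec M),
    ‖gradient (fun w => L.Q p w (L.x p n)) w₂ - gradient (fun w => L.Q p w (L.x p n)) w₁‖
      ≤ δ * ‖w₂ - w₁‖

/-- Bounded model drift: `wo` minimizes the aggregate cost, `wloc p` minimizes the risk of agent
`p`, and every local minimizer is within `ξ` of the global one. -/
structure ModelDrift (ξ : ℝ) (wo : Vec M) (wloc : Fin P → Vec M) : Prop where
  global_min : IsMinOn L.aggregate Set.univ wo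
  local_min : ∀ p, IsMinOn (L.risk p) Set.univ (wloc p)
  drift : ∀ p, ‖wo - wloc p‖ ≤ ξ

end LearningProblem

/-! ### The combination matrices -/

/-- The conditions on the combination matrices `A 0`, `A 1`, `A 2` (the entry `A j m p` is the
weight which agent `p` gives to information arriving from agent `m`; it vanishes when `m` is not a
neighbour of `p`): each is left-stochastic, the network is strongly connected in the sense that
`A₁ A₀ A₂` is primitive, and `q` is the Perron eigenvector of `A₁ A₀ A₂`, that is,
`qᵀ A₂ᵀ A₀ᵀ A₁ᵀ = qᵀ`, with positive entries adding up to one. -/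
structure CombinationPolicy {P : ℕ} (A : Fin 3 → Matrix (Fin P) (Fin P) ℝ) (q : Fin P → ℝ) :
    Prop where
  left_stochastic : ∀ j, A j ∈ Matrix.colStochastic ℝ (Fin P)
  primitive : (A 1 * A 0 * A 2).IsPrimitive
  perron_pos : ∀ p, 0 < q p
  perron_sum : ∑ p, q p = 1
  perron_eq : (A 1 * A 0 * A 2) *ᵥ q = q

/-! ### The privatized recursion

Time is shifted by one in the noise and in the gradient approximation: index `i` refers to the
quantities used in iteration `i + 1`, which leads from the models at time `i` to those at time
`i + 1`. -/

/-- Agent `p` combines the noisy messages `u m + g m p` received from the agents `m`. -/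
def combine {P M : ℕ} (A : Matrix (Fin P) (Fin P) ℝ) (u : Fin P → Vec M)
    (g : Fin P → Fin P → Vec M) (p : Fin P) : Vec M :=
  ∑ m, A m p • (u m + g m p)

/-- One iteration of the privatized generalized consensus/diffusion recursion: pre-combination,
update with the gradient approximation `gradHat p` evaluated at the pre-combined model, and
post-combination. Here `g j m p` is the noise added in stage `j` to the message from `m` to `p`. -/
def privStep {P M : ℕ} (A : Fin 3 → Matrix (Fin P) (Fin P) ℝ) (μ : ℝ)
    (gradHat : Fin P → Vec M → Vec M) (g : Fin 3 → Fin P → Fin P → Vec M)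
    (w : Fin P → Vec M) : Fin P → Vec M :=
  let φ : Fin P → Vec M := combine (A 1) w (g 1)
  let ψ : Fin P → Vec M := fun p => combine (A 0) φ (g 0) p - μ • gradHat p (φ p)
  combine (A 2) ψ (g 2)

/-- The models `w_{p,i}` produced by the recursion from the initial models `w0`. -/
def privModel {P M : ℕ} (A : Fin 3 → Matrix (Fin P) (Fin P) ℝ) (μ : ℝ) (w0 : Fin P → Vec M)
    (gradHat : ℕ → Fin P → Vec M → Vec M) (g : ℕ → Fin 3 → Fin P → Fin P → Vec M) :
    ℕ → Fin P → Vec M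
  | 0 => w0
  | i + 1 => privStep A μ (gradHat i) (g i) (privModel A μ w0 gradHat g i)

/-! ### The random processes -/

/-- The centred Laplace distribution on `ℝ` with scale `b`, of density `exp (-|x| / b) / (2 b)`;
its variance is `2 b ^ 2`. -/
def laplaceMeasure (b : ℝ) : Measure ℝ :=
  volume.withDensity fun x => ENNReal.ofReal (1 / (2 * b) * Real.exp (-|x| / b))

/-- The random inputs of the recursion: the initial models, the (random) gradient approximations
`w ↦ gradHat i p ω w`, and the privacy noises. -/
structure RandomInputs (P M : ℕ) (Ω : Type*) where
  w0 : Fin P → Ω → Vec M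
  gradHat : ℕ → Fin P → Ω → Vec M → Vec M
  g : ℕ → Fin 3 → Fin P → Fin P → Ω → Vec M

namespace RandomInputs

variable {P M : ℕ} {Ω : Type*} (R : RandomInputs P M Ω)
  (A : Fin 3 → Matrix (Fin P) (Fin P) ℝ) (μ : ℝ)

/-- The random model `w_{p,i}`. -/
def model (i : ℕ) (p : Fin P) (ω : Ω) : Vec M :=
  privModel A μ (fun p => R.w0 p ω) (fun i p => R.gradHat i p ω) (fun i j m p => R.g i j m p ω) i p

/-- The random pre-combined model `φ_{p,i}`, at which the gradient is evaluated in iteration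
`i + 1`. -/
def preModel (i : ℕ) (p : Fin P) (ω : Ω) : Vec M :=
  combine (A 1) (fun m => R.model A μ i m ω) (fun m p => R.g i 1 m p ω) p

/-- The gradient noise: the value of the gradient approximation minus the true gradient. -/
def gradNoise {X : Type*} (L : LearningProblem P M X) (i : ℕ) (p : Fin P) (ω : Ω) : Vec M :=
  R.gradHat i p ω (R.preModel A μ i p ω) - gradient (L.risk p) (R.preModel A μ i p ω)

/-- The σ-algebra generated by the models `w_{p,j}`, for all agents `p` and all times `j ≤ i`. -/
@[reducible] def past (i : ℕ) : MeasurableSpace Ω :=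
  ⨆ (j : ℕ) (_ : j ≤ i) (p : Fin P), MeasurableSpace.comap (R.model A μ j p) inferInstance

/-- The squared norm of the network error `col {wo - w_{p,i}}`. -/
def errSq (wo : Vec M) (i : ℕ) (ω : Ω) : ℝ :=
  ∑ p, ‖wo - R.model A μ i p ω‖ ^ 2

/-- The initial models are square-integrable random vectors. -/
structure SquareIntegrableStart [MeasurableSpace Ω] (Pr : Measure Ω) : Prop where
  measurable : ∀ p, Measurable (R.w0 p)
  memLp : ∀ p, MemLp (R.w0 p) 2 Pr

/-- The privacy noises are zero-mean Laplacian random vectors with coordinates of variance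
`σg ^ 2`; they are independent of each other, and the noises of each iteration are independent of
the past models. -/
structure LaplacianNoise [MeasurableSpace Ω] (Pr : Measure Ω) (σg : ℝ) : Prop where
  measurable : ∀ i j m p, Measurable (R.g i j m p)
  law : ∀ i j m p (k : Fin M),
    Measure.map (fun ω => R.g i j m p ω k) Pr = laplaceMeasure (σg / √2)
  indep : iIndepFun
    (fun (t : ℕ × Fin 3 × Fin P × Fin P) => R.g t.1 t.2.1 t.2.2.1 t.2.2.2) Pr
  indep_past : ∀ i, Indep
    (⨆ (j : Fin 3) (m : Fin P) (p : Fin P),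
      MeasurableSpace.comap (R.g i j m p) inferInstance) (R.past A μ i) Pr

/-- The gradient noise is square-integrable, has zero mean given the past models, and its second
moment given the past models is at most that of `β_{s,p}² ‖wo - φ_{p,i}‖² + σ_{s,p}²`. -/
structure BoundedGradientNoise [MeasurableSpace Ω] (Pr : Measure Ω) {X : Type*}
    (L : LearningProblem P M X) (wo : Vec M) (βs σs : Fin P → ℝ) : Prop where
  measurable : ∀ i p, Measurable (R.gradNoise A μ L i p)
  memLp : ∀ i p, MemLp (R.gradNoise A μ L i p) 2 Pr
  zero_mean : ∀ i p, Pr[R.gradNoise A μ L i p | R.past A μ i] =ᵐ[Pr] 0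
  second_moment : ∀ i p,
    Pr[fun ω => ‖R.gradNoise A μ L i p ω‖ ^ 2 | R.past A μ i] ≤ᵐ[Pr]
      Pr[fun ω => βs p ^ 2 * ‖wo - R.preModel A μ i p ω‖ ^ 2 + σs p ^ 2 | R.past A μ i]

end RandomInputs

end

set_option linter.unusedSectionVars false

/-! The network error evolves by a noiseless drift, a perturbation with conditional mean zero, and a
small shift of the gradients. All three are measured by `‖Φ u‖ ^ 2` for one fixed linear map `Φ`,
which records the weighted mean and the disagreement of the agents.

The drift has two time scales. Put `B = A 1 * A 0 * A 2`. Mixing by `B` preserves the `q`-weighted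
mean, so the mean moves only by the gradient term, whose weights turn out to be `A 2 *ᵥ q`. Since
`wo` minimizes the cost with these weights, the gradients balance there, and strong convexity
contracts the mean at a rate of order `μ`, up to a term in the disagreement
(`norm_centroid_driftStep_sq_le`). The disagreement contracts at a rate free of `μ`: some power `B ^
K` is positive, hence contracts mean-zero vectors, and summing over `K` steps gives a Lyapunov
function for `B` itself (`exists_disagreement_lyapunov`). The individual gradients at `wo` need not
vanish, but their size is controlled by the model drift, and they disturb the disagreement only to
order `μ ^ 2`. For small `μ` the fast contraction absorbs the coupling (`exists_drift_lyapunov`).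

Because `Φ` is linear, the cross term between the past-measurable drift and the centred noise
vanishes in expectation (`integral_norm_sq_add_add_le`). The part of the gradient-noise variance
proportional to the error carries a factor `μ ^ 2` and is absorbed. Noise inside the gradients is no
longer centred, but by the Lipschitz bound it is small enough for Young's inequality with a
parameter proportional to `μ`. What remains is a scalar recursion with factor `1 - a / 4 * μ` and a
floor of order `μ²σs² + μ² + σg²`; summing the geometric series divides the floor by `μ`. -/

noncomputable section

/-! ### Combination matrices, weighted means and decay of disagreement. -/

section Mixing

variable {P : ℕ} {E : Type*} [NormedAddCommGroup E] [InnerProductSpace ℝ E]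

/-- The combination `u ↦ Aᵀ u` of a network vector `u`, blockwise. -/
def mix (A : Matrix (Fin P) (Fin P) ℝ) : (Fin P → E) →ₗ[ℝ] (Fin P → E) where
  toFun u p := ∑ m, A m p • u m
  map_add' u v := by ext p; simp [Finset.sum_add_distrib]
  map_smul' c u := by
    ext p
    simp only [Pi.smul_apply, RingHom.id_apply, Finset.smul_sum]
    exact Finset.sum_congr rfl fun m _ => smul_comm _ _ _

theorem mix_apply (A : Matrix (Fin P) (Fin P) ℝ) (u : Fin P → E) (p : Fin P) :
    mix A u p = ∑ m, A m p • u m := rfl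

theorem mix_mix (A B : Matrix (Fin P) (Fin P) ℝ) (u : Fin P → E) :
    mix B (mix A u) = mix (A * B) u := by
  ext p
  simp only [mix_apply, Finset.smul_sum, Matrix.mul_apply, Finset.sum_smul, smul_smul]
  rw [Finset.sum_comm]
  exact Finset.sum_congr rfl fun m _ => Finset.sum_congr rfl fun k _ => by rw [mul_comm]

theorem mix_one (u : Fin P → E) : mix (1 : Matrix (Fin P) (Fin P) ℝ) u = u := by
  ext p
  simp [mix_apply, Matrix.one_apply]

theorem mix_const {A : Matrix (Fin P) (Fin P) ℝ} (hA : A ∈ Matrix.colStochastic ℝ (Fin P))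
    (x : E) : mix A (fun _ => x) = fun _ => x := by
  ext p
  rw [mix_apply, ← Finset.sum_smul, Matrix.sum_col_of_mem_colStochastic hA, one_smul]

/-- Triangle inequality, then Cauchy–Schwarz. Weights of total less than one are allowed because
minorization removes mass from a stochastic column. -/
theorem norm_sum_smul_sq_le {ι : Type*} (s : Finset ι) (a : ι → ℝ) (v : ι → E)
    (ha : ∀ i ∈ s, 0 ≤ a i) (hs : ∑ i ∈ s, a i ≤ 1) :
    ‖∑ i ∈ s, a i • v i‖ ^ 2 ≤ ∑ i ∈ s, a i * ‖v i‖ ^ 2 := by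
  have h1 : ‖∑ i ∈ s, a i • v i‖ ≤ ∑ i ∈ s, a i * ‖v i‖ :=
    (norm_sum_le _ _).trans (Finset.sum_le_sum fun i hi => by
      rw [norm_smul, Real.norm_of_nonneg (ha i hi)])
  have h2 : (∑ i ∈ s, a i * ‖v i‖) ^ 2 ≤ (∑ i ∈ s, a i) * ∑ i ∈ s, a i * ‖v i‖ ^ 2 :=
    Finset.sum_sq_le_sum_mul_sum_of_sq_le_mul s ha
      (fun i hi => mul_nonneg (ha i hi) (sq_nonneg _)) fun i _ => le_of_eq (by ring)
  have h3 : 0 ≤ ∑ i ∈ s, a i * ‖v i‖ ^ 2 :=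
    Finset.sum_nonneg fun i hi => mul_nonneg (ha i hi) (sq_nonneg _)
  calc _ ≤ (∑ i ∈ s, a i * ‖v i‖) ^ 2 := by gcongr
    _ ≤ _ := h2
    _ ≤ _ := by nlinarith

/-- The squared norm of a network vector. -/
def netSq (u : Fin P → E) : ℝ := ∑ p, ‖u p‖ ^ 2

/-- The squared norm of a network vector with the weights `q`. -/
def weightedSq (q : Fin P → ℝ) (u : Fin P → E) : ℝ := ∑ p, q p * ‖u p‖ ^ 2

theorem netSq_nonneg (u : Fin P → E) : 0 ≤ netSq u := Finset.sum_nonneg fun _ _ => sq_nonneg _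

theorem netSq_add_le (u v : Fin P → E) : netSq (u + v) ≤ 2 * netSq u + 2 * netSq v := by
  simp only [netSq, Finset.mul_sum, ← Finset.sum_add_distrib]
  refine Finset.sum_le_sum fun p _ => ?_
  have := norm_add_le (u p) (v p)
  have h0 := norm_nonneg (u p + v p)
  simp only [Pi.add_apply]
  nlinarith [sq_nonneg (‖u p‖ - ‖v p‖)]

theorem netSq_smul (c : ℝ) (u : Fin P → E) : netSq (c • u) = c ^ 2 * netSq u := by
  simp [netSq, norm_smul, mul_pow, Finset.mul_sum]

theorem norm_mix_sq_le {A : Matrix (Fin P) (Fin P) ℝ} (hA : A ∈ Matrix.colStochastic ℝ (Fin P))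
    (u : Fin P → E) (p : Fin P) : ‖mix A u p‖ ^ 2 ≤ ∑ m, A m p * ‖u m‖ ^ 2 :=
  norm_sum_smul_sq_le _ _ _ (fun _ _ => Matrix.nonneg_of_mem_colStochastic hA)
    (Matrix.sum_col_of_mem_colStochastic hA p).le

theorem netSq_mix_le {A : Matrix (Fin P) (Fin P) ℝ} (hA : A ∈ Matrix.colStochastic ℝ (Fin P))
    (u : Fin P → E) : netSq (mix A u) ≤ P * netSq u := by
  calc netSq (mix A u) ≤ ∑ _p : Fin P, netSq u := Finset.sum_le_sum fun p _ =>
        (norm_mix_sq_le hA u p).trans (Finset.sum_le_sum fun m _ =>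
          mul_le_of_le_one_left (sq_nonneg _) (Matrix.le_one_of_mem_colStochastic hA))
    _ = _ := by simp

/-- Convexity in each column; exchanging the sums moves the weights from `q` to `A *ᵥ q`. If `q` is
fixed, mixing is nonexpansive in this norm. -/
theorem weightedSq_mix_le {A : Matrix (Fin P) (Fin P) ℝ} {q : Fin P → ℝ}
    (hA : A ∈ Matrix.colStochastic ℝ (Fin P)) (hq : ∀ p, 0 ≤ q p) (u : Fin P → E) :
    weightedSq q (mix A u) ≤ weightedSq (A *ᵥ q) u := by
  calc weightedSq q (mix A u) ≤ ∑ p, q p * ∑ m, A m p * ‖u m‖ ^ 2 :=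
        Finset.sum_le_sum fun p _ => mul_le_mul_of_nonneg_left (norm_mix_sq_le hA u p) (hq p)
    _ = _ := by
      simp only [weightedSq, Matrix.mulVec, dotProduct, Finset.mul_sum, Finset.sum_mul]
      rw [Finset.sum_comm]
      exact Finset.sum_congr rfl fun m _ => Finset.sum_congr rfl fun k _ => by ring

/-- The weighted mean of a network vector. -/
def centroid (q : Fin P → ℝ) : (Fin P → E) →ₗ[ℝ] E where
  toFun u := ∑ p, q p • u p
  map_add' u v := by simp [Finset.sum_add_distrib]
  map_smul' c u := by
    simp only [Pi.smul_apply, RingHom.id_apply, Finset.smul_sum]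
    exact Finset.sum_congr rfl fun m _ => smul_comm _ _ _

theorem centroid_apply (q : Fin P → ℝ) (u : Fin P → E) : centroid q u = ∑ p, q p • u p := rfl

theorem centroid_mix (A : Matrix (Fin P) (Fin P) ℝ) (q : Fin P → ℝ) (u : Fin P → E) :
    centroid q (mix A u) = centroid (A *ᵥ q) u := by
  simp only [centroid_apply, mix_apply, Matrix.mulVec, dotProduct, Finset.smul_sum,
    Finset.sum_smul, smul_smul]
  rw [Finset.sum_comm]
  exact Finset.sum_congr rfl fun m _ => Finset.sum_congr rfl fun k _ => by rw [mul_comm]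

/-- The deviation of a network vector from its weighted mean. -/
def disagreement (q : Fin P → ℝ) : (Fin P → E) →ₗ[ℝ] (Fin P → E) :=
  LinearMap.id - LinearMap.pi fun _ => centroid q

theorem disagreement_apply (q : Fin P → ℝ) (u : Fin P → E) (p : Fin P) :
    disagreement q u p = u p - centroid q u := rfl

theorem disagreement_mix {A : Matrix (Fin P) (Fin P) ℝ} {q : Fin P → ℝ}
    (hA : A ∈ Matrix.colStochastic ℝ (Fin P)) (hq : A *ᵥ q = q) (u : Fin P → E) :
    disagreement q (mix A u) = mix A (disagreement q u) := by
  have h : disagreement q u = u - fun _ => centroid q u := rfl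
  rw [h, map_sub, mix_const hA]
  ext p
  rw [disagreement_apply, centroid_mix, hq]
  rfl

theorem centroid_disagreement {q : Fin P → ℝ} (hq : ∑ p, q p = 1) (u : Fin P → E) :
    centroid q (disagreement q u) = 0 := by
  simp only [centroid_apply q (disagreement q u), disagreement_apply, smul_sub,
    Finset.sum_sub_distrib, ← Finset.sum_smul, hq, one_smul]
  exact sub_self _

theorem norm_centroid_sq_le {q : Fin P → ℝ} (hq : ∀ p, 0 ≤ q p) (hs : ∑ p, q p = 1)
    (u : Fin P → E) : ‖centroid q u‖ ^ 2 ≤ netSq u :=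
  (norm_sum_smul_sq_le _ _ _ (fun p _ => hq p) hs.le).trans (Finset.sum_le_sum fun p _ =>
    mul_le_of_le_one_left (sq_nonneg _)
      (hs ▸ Finset.single_le_sum (fun p _ => hq p) (Finset.mem_univ p)))

theorem netSq_const (x : E) : netSq (fun _ : Fin P => x) = P * ‖x‖ ^ 2 := by simp [netSq]

theorem netSq_le_centroid_add_disagreement (q : Fin P → ℝ) (u : Fin P → E) :
    netSq u ≤ 2 * (P * ‖centroid q u‖ ^ 2) + 2 * netSq (disagreement q u) := by
  have h : u = (fun _ => centroid q u) + disagreement q u := by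
    ext p; simp [disagreement_apply]
  calc netSq u = netSq ((fun _ => centroid q u) + disagreement q u) := by rw [← h]
    _ ≤ _ := by rw [← netSq_const]; exact netSq_add_le _ _

theorem netSq_disagreement_le {q : Fin P → ℝ} (hq : ∀ p, 0 ≤ q p) (hs : ∑ p, q p = 1)
    (u : Fin P → E) : netSq (disagreement q u) ≤ (2 + 2 * P) * netSq u := by
  have h : disagreement q u = u + fun _ => -centroid q u := by
    ext p; simp [disagreement_apply, sub_eq_add_neg]
  have h1 := netSq_add_le u fun _ => -centroid q u
  rw [← h, netSq_const, norm_neg] at h1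
  have h2 := norm_centroid_sq_le hq hs u
  nlinarith [mul_le_mul_of_nonneg_left h2 (Nat.cast_nonneg (α := ℝ) P)]

/-- A stochastic matrix with fixed vector `q` whose entries dominate those of `ε q 1ᵀ` contracts
the weighted norm on the network vectors with weighted mean zero. -/
theorem weightedSq_mix_le_of_minorized {S : Matrix (Fin P) (Fin P) ℝ} {q : Fin P → ℝ} {ε : ℝ}
    (hS : S ∈ Matrix.colStochastic ℝ (Fin P)) (hq : ∀ p, 0 ≤ q p) (hs : ∑ p, q p = 1)
    (hfix : S *ᵥ q = q) (hε : 0 ≤ ε) (hmin : ∀ m p, ε * q m ≤ S m p) (v : Fin P → E)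
    (hv : centroid q v = 0) : weightedSq q (mix S v) ≤ (1 - ε) * weightedSq q v := by
  -- On mean-zero vectors the rank-one part `ε q 1ᵀ` acts as zero, so it can be subtracted while the
  -- weights stay nonnegative.
  have h1 : ∀ p, mix S v p = ∑ m, (S m p - ε * q m) • v m := fun p => by
    have : ∑ m, (ε * q m) • v m = 0 := by
      simp only [mul_smul, ← Finset.smul_sum]
      rw [← centroid_apply, hv, smul_zero]
    simp only [sub_smul, Finset.sum_sub_distrib, this, sub_zero, mix_apply]
  have h2 : ∀ p, ‖mix S v p‖ ^ 2 ≤ ∑ m, (S m p - ε * q m) * ‖v m‖ ^ 2 := fun p => by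
    rw [h1]
    refine norm_sum_smul_sq_le _ _ _ (fun m _ => sub_nonneg.2 (hmin m p)) ?_
    rw [Finset.sum_sub_distrib, ← Finset.mul_sum, hs, Matrix.sum_col_of_mem_colStochastic hS]
    linarith
  -- Stationarity of `q`: after the sums are exchanged, `‖v m‖ ^ 2` carries the weight `q m - ε * q
  -- m`.
  have h3 : ∀ m, ∑ p, q p * S m p = q m := fun m => by
    conv_rhs => rw [← hfix]
    exact Finset.sum_congr rfl fun p _ => mul_comm _ _
  calc weightedSq q (mix S v) ≤ ∑ p, q p * ∑ m, (S m p - ε * q m) * ‖v m‖ ^ 2 :=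
        Finset.sum_le_sum fun p _ => mul_le_mul_of_nonneg_left (h2 p) (hq p)
    _ = ∑ m, (∑ p, q p * S m p - (∑ p, q p) * (ε * q m)) * ‖v m‖ ^ 2 := by
      simp only [Finset.mul_sum, Finset.sum_mul, ← Finset.sum_sub_distrib]
      rw [Finset.sum_comm]
      exact Finset.sum_congr rfl fun m _ => Finset.sum_congr rfl fun p _ => by ring
    _ = _ := by
      simp only [h3, hs, weightedSq, Finset.mul_sum]
      exact Finset.sum_congr rfl fun m _ => by ring

theorem mulVec_pow_fixed {B : Matrix (Fin P) (Fin P) ℝ} {q : Fin P → ℝ} (h : B *ᵥ q = q) (k : ℕ) :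
    (B ^ k) *ᵥ q = q := by
  induction k with
  | zero => simp
  | succ k ih => rw [pow_succ, ← Matrix.mulVec_mulVec, h, ih]

/-- The disagreement of a network vector, observed over `K` combination steps: the squared norm of
this linear map is a Lyapunov function of the combination. -/
def disagreementOrbit (B : Matrix (Fin P) (Fin P) ℝ) (q : Fin P → ℝ) (K : ℕ) :
    (Fin P → E) →ₗ[ℝ] PiLp 2 (fun _ : Fin K × Fin P => E) :=
  (WithLp.linearEquiv 2 ℝ (Fin K × Fin P → E)).symm.toLinearMap ∘ₗ
    LinearMap.pi fun k => √(q k.2) • LinearMap.proj k.2 ∘ₗ mix (B ^ (k.1 : ℕ)) ∘ₗ disagreement q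

theorem norm_disagreementOrbit_sq (B : Matrix (Fin P) (Fin P) ℝ) {q : Fin P → ℝ}
    (hq : ∀ p, 0 ≤ q p) (K : ℕ) (u : Fin P → E) :
    ‖disagreementOrbit B q K u‖ ^ 2 =
      ∑ k ∈ Finset.range K, weightedSq q (mix (B ^ k) (disagreement q u)) := by
  rw [PiLp.norm_sq_eq_of_L2, Fintype.sum_prod_type, ← Fin.sum_univ_eq_sum_range
    (fun k => weightedSq q (mix (B ^ k) (disagreement q u)))]
  refine Finset.sum_congr rfl fun k _ => Finset.sum_congr rfl fun p _ => ?_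
  have : (disagreementOrbit B q K u) (k, p) = √(q p) • mix (B ^ (k : ℕ)) (disagreement q u) p := rfl
  rw [this, norm_smul, mul_pow, Real.norm_eq_abs, sq_abs, Real.sq_sqrt (hq p)]

/-- Mixing by `B` shifts the orbit sum by one: the term at `0` is lost and the term at `K` gained.
By minorization the gained term is at most `1 - ε` times the lost one, and the lost term is at least
the fraction `1 / K` of the sum, so the sum shrinks by the fraction `ε / K`. -/
theorem exists_disagreement_lyapunov {B : Matrix (Fin P) (Fin P) ℝ} {q : Fin P → ℝ}
    (hB : B ∈ Matrix.colStochastic ℝ (Fin P)) (hprim : B.IsPrimitive) (hq : ∀ p, 0 < q p)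
    (hs : ∑ p, q p = 1) (hfix : B *ᵥ q = q) (E : Type*) [NormedAddCommGroup E]
    [InnerProductSpace ℝ E] :
    ∃ (K : ℕ) (ρ k₁ k₂ : ℝ), 0 < ρ ∧ 0 ≤ k₁ ∧ 0 ≤ k₂ ∧ ∀ u : Fin P → E,
      ‖disagreementOrbit B q K (mix B u)‖ ^ 2 ≤ (1 - ρ) * ‖disagreementOrbit B q K u‖ ^ 2 ∧
      netSq (disagreement q u) ≤ k₁ * ‖disagreementOrbit B q K u‖ ^ 2 ∧
      ‖disagreementOrbit B q K u‖ ^ 2 ≤ k₂ * netSq u := by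
  obtain ⟨K, hK, hpos⟩ := hprim.exists_pos_pow
  have hP : Nonempty (Fin P) := by
    by_contra h
    rw [not_nonempty_iff] at h
    simp at hs
  have hq0 : ∀ p, 0 ≤ q p := fun p => (hq p).le
  have hq1 : ∀ p, q p ≤ 1 := fun p => hs ▸ Finset.single_le_sum (fun p _ => hq0 p) (Finset.mem_univ p)
  have hBk : ∀ k, B ^ k ∈ Matrix.colStochastic ℝ (Fin P) := fun k => pow_mem hB k
  -- The least entry of the positive matrix `B ^ K` serves as `ε`, since every `q m` is at most one.
  obtain ⟨x₀, hx₀⟩ := Finite.exists_min fun x : Fin P × Fin P => (B ^ K) x.1 x.2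
  obtain ⟨p₀, hp₀⟩ := Finite.exists_min q
  set ε := (B ^ K) x₀.1 x₀.2
  have hε : 0 < ε := hpos _ _
  have hmin : ∀ m p, ε * q m ≤ (B ^ K) m p := fun m p =>
    (mul_le_of_le_one_right hε.le (hq1 m)).trans (hx₀ (m, p))
  have hK1 : (1 : ℝ) ≤ K := by exact_mod_cast hK
  have hstep : ∀ (k : ℕ) (v : Fin P → E), weightedSq q (mix (B ^ k) v) ≤ weightedSq q v :=
    fun k v => by
      have := weightedSq_mix_le (hBk k) hq0 v
      rwa [mulVec_pow_fixed hfix] at this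
  have hnn : ∀ v : Fin P → E, 0 ≤ weightedSq q v := fun v =>
    Finset.sum_nonneg fun p _ => mul_nonneg (hq0 p) (sq_nonneg _)
  have hle : ∀ u : Fin P → E, ‖disagreementOrbit B q K u‖ ^ 2 ≤ K * weightedSq q (disagreement q u) :=
    fun u => by
      rw [norm_disagreementOrbit_sq B hq0]
      refine (Finset.sum_le_sum fun k _ => hstep k _).trans_eq ?_
      simp
  refine ⟨K, ε / K, (q p₀)⁻¹, K * (2 + 2 * P), by positivity, inv_nonneg.2 (hq0 p₀),
    by positivity, fun u => ⟨?_, ?_, ?_⟩⟩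
  · have h1 : ‖disagreementOrbit B q K (mix B u)‖ ^ 2 =
        ‖disagreementOrbit B q K u‖ ^ 2 - weightedSq q (disagreement q u) +
          weightedSq q (mix (B ^ K) (disagreement q u)) := by
      rw [norm_disagreementOrbit_sq B hq0, norm_disagreementOrbit_sq B hq0, disagreement_mix hB hfix]
      simp only [mix_mix, ← pow_succ']
      have h2 := Finset.sum_range_succ' (fun k => weightedSq q (mix (B ^ k) (disagreement q u))) K
      rw [Finset.sum_range_succ, pow_zero, mix_one] at h2
      linarith
    have h2 := weightedSq_mix_le_of_minorized (hBk K) hq0 hs (mulVec_pow_fixed hfix K) hε.le hmin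
      (disagreement q u) (centroid_disagreement hs u)
    have h3 : ε / K * ‖disagreementOrbit B q K u‖ ^ 2 ≤ ε * weightedSq q (disagreement q u) := by
      rw [div_mul_eq_mul_div, div_le_iff₀ (by linarith), mul_assoc]
      exact mul_le_mul_of_nonneg_left ((hle u).trans_eq (mul_comm _ _)) hε.le
    rw [h1]
    linarith
  · rw [inv_mul_eq_div, le_div_iff₀ (hq p₀), norm_disagreementOrbit_sq B hq0]
    calc netSq (disagreement q u) * q p₀ ≤ weightedSq q (disagreement q u) := by
          rw [netSq, Finset.sum_mul]
          refine Finset.sum_le_sum fun p _ => ?_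
          rw [mul_comm]
          exact mul_le_mul_of_nonneg_right (hp₀ p) (sq_nonneg _)
      _ = weightedSq q (mix (B ^ 0) (disagreement q u)) := by rw [pow_zero, mix_one]
      _ ≤ _ := Finset.single_le_sum (f := fun k => weightedSq q (mix (B ^ k) (disagreement q u)))
          (fun k _ => hnn _) (Finset.mem_range.2 hK)
  · refine (hle u).trans ?_
    rw [mul_assoc]
    refine mul_le_mul_of_nonneg_left ?_ (by linarith)
    refine le_trans ?_ (netSq_disagreement_le hq0 hs u)
    exact Finset.sum_le_sum fun p _ => mul_le_of_le_one_left (sq_nonneg _) (hq1 p)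

end Mixing

/-! ### Contraction of the noiseless iteration. -/

section Drift

variable {P : ℕ} {E : Type*} [NormedAddCommGroup E] [InnerProductSpace ℝ E]

theorem norm_add_sq_le_of_pos (a b : E) {t : ℝ} (ht : 0 < t) :
    ‖a + b‖ ^ 2 ≤ (1 + t) * ‖a‖ ^ 2 + (1 + t⁻¹) * ‖b‖ ^ 2 := by
  have h1 := norm_add_le a b
  have h2 : 0 ≤ t⁻¹ * (t * ‖a‖ - ‖b‖) ^ 2 := by positivity
  have h3 : t⁻¹ * (t * ‖a‖ - ‖b‖) ^ 2 = t * ‖a‖ ^ 2 - 2 * ‖a‖ * ‖b‖ + t⁻¹ * ‖b‖ ^ 2 := by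
    field_simp; ring
  nlinarith [norm_nonneg (a + b), norm_nonneg a, norm_nonneg b]

/-- The gradients `f p` of the agents, centred at a common minimizer of the cost with weights `r`:
they are `δ`-Lipschitz and `ν`-strongly monotone, and they balance at the origin, where they have
size at most `κ`. -/
structure CenteredField (r : Fin P → ℝ) (ν δ κ : ℝ) (f : Fin P → E → E) : Prop where
  lipschitz : ∀ p x y, ‖f p x - f p y‖ ≤ δ * ‖x - y‖
  monotone : ∀ p x y, ν * ‖x - y‖ ^ 2 ≤ inner ℝ (f p x - f p y) (x - y)
  at_zero : ∀ p, ‖f p 0‖ ≤ κ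
  balanced : ∑ p, r p • f p 0 = 0

/-- The noiseless iteration, for the errors of the models. -/
def driftStep (A : Fin 3 → Matrix (Fin P) (Fin P) ℝ) (μ : ℝ) (f : Fin P → E → E)
    (u : Fin P → E) : Fin P → E :=
  mix (A 1 * A 0 * A 2) u - μ • mix (A 2) fun m => f m (mix (A 1) u m)

variable {A : Fin 3 → Matrix (Fin P) (Fin P) ℝ} {q : Fin P → ℝ} {ν δ κ μ : ℝ} {f : Fin P → E → E}

theorem CombinationPolicy.product_mem (hA : CombinationPolicy A q) :
    A 1 * A 0 * A 2 ∈ Matrix.colStochastic ℝ (Fin P) :=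
  mul_mem (mul_mem (hA.left_stochastic 1) (hA.left_stochastic 0)) (hA.left_stochastic 2)

theorem CombinationPolicy.weight_nonneg (hA : CombinationPolicy A q) (p : Fin P) :
    0 ≤ (A 2 *ᵥ q) p := by
  rw [Matrix.mulVec, dotProduct]
  exact Finset.sum_nonneg fun m _ => mul_nonneg
    (Matrix.nonneg_of_mem_colStochastic (hA.left_stochastic 2)) (hA.perron_pos m).le

theorem CombinationPolicy.weight_sum (hA : CombinationPolicy A q) : ∑ p, (A 2 *ᵥ q) p = 1 := by
  rw [Matrix.sum_mulVec_of_mem_colStochastic (hA.left_stochastic 2), hA.perron_sum]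

/-- Balance at the origin allows each `f m x` to be replaced by `f m x - f m 0`, so no bias appears.
The factor is then `1 - 2μν + μ²δ²`, and `μδ² ≤ ν`. -/
theorem norm_gradient_step_sq_le {r : Fin P → ℝ} (hr : ∀ p, 0 ≤ r p) (hr1 : ∑ p, r p = 1)
    (hf : CenteredField r ν δ κ f) (hμ : 0 < μ) (hμδ : μ * δ ^ 2 ≤ ν) (x : E) :
    ‖x - μ • ∑ m, r m • f m x‖ ^ 2 ≤ (1 - μ * ν) * ‖x‖ ^ 2 := by
  have h0 : ∑ m, r m • f m x = ∑ m, r m • (f m x - f m 0) := by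
    simp [smul_sub, Finset.sum_sub_distrib, hf.balanced]
  have h1 : ‖∑ m, r m • f m x‖ ^ 2 ≤ δ ^ 2 * ‖x‖ ^ 2 := by
    rw [h0]
    calc _ ≤ ∑ m, r m * ‖f m x - f m 0‖ ^ 2 :=
          norm_sum_smul_sq_le _ _ _ (fun m _ => hr m) hr1.le
      _ ≤ ∑ m, r m * (δ ^ 2 * ‖x‖ ^ 2) := by
        refine Finset.sum_le_sum fun m _ => mul_le_mul_of_nonneg_left ?_ (hr m)
        have := hf.lipschitz m x 0
        rw [sub_zero] at this
        rw [← mul_pow]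
        gcongr
      _ = _ := by rw [← Finset.sum_mul, hr1, one_mul]
  have h2 : ν * ‖x‖ ^ 2 ≤ inner ℝ x (∑ m, r m • f m x) := by
    rw [h0, inner_sum]
    calc ν * ‖x‖ ^ 2 = ∑ m, r m * (ν * ‖x‖ ^ 2) := by rw [← Finset.sum_mul, hr1, one_mul]
      _ ≤ _ := Finset.sum_le_sum fun m _ => by
        rw [inner_smul_right, real_inner_comm]
        have := hf.monotone m x 0
        rw [sub_zero] at this
        exact mul_le_mul_of_nonneg_left this (hr m)
  rw [norm_sub_sq_real, inner_smul_right, norm_smul, mul_pow, Real.norm_eq_abs, sq_abs]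
  nlinarith [mul_le_mul_of_nonneg_left h1 (sq_nonneg μ), mul_le_mul_of_nonneg_left h2 hμ.le,
    mul_le_mul_of_nonneg_right hμδ (mul_nonneg hμ.le (sq_nonneg ‖x‖))]

/-- The mean makes a gradient step for the cost with weights `A 2 *ᵥ q`, except that the gradients
are taken at the mixed models instead of the mean; the difference is Lipschitz in the disagreement.
-/
theorem norm_centroid_driftStep_sq_le (hA : CombinationPolicy A q)
    (hf : CenteredField (A 2 *ᵥ q) ν δ κ f) (hν : 0 < ν) (hμ : 0 < μ)
    (hμδ : μ * δ ^ 2 ≤ ν) (u : Fin P → E) :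
    ‖centroid q (driftStep A μ f u)‖ ^ 2 ≤ (1 - μ * ν / 2) * ‖centroid q u‖ ^ 2 +
      (μ ^ 2 + 2 * μ / ν) * (δ ^ 2 * P * netSq (disagreement q u)) := by
  set r := A 2 *ᵥ q with hr
  have hr0 : ∀ p, 0 ≤ r p := hA.weight_nonneg
  have hr1 : ∑ p, r p = 1 := hA.weight_sum
  set x := centroid q u with hx
  set a := x - μ • ∑ m, r m • f m x with ha
  set d := ∑ m, r m • (f m (mix (A 1) u m) - f m x) with hd
  have h0 : centroid q (driftStep A μ f u) = a + (-μ) • d := by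
    rw [driftStep, map_sub, map_smul, centroid_mix, centroid_mix, hA.perron_eq, ha, hd,
      centroid_apply (A 2 *ᵥ q)]
    simp only [smul_sub, Finset.sum_sub_distrib, neg_smul]
    abel
  have h1 : ‖a‖ ^ 2 ≤ (1 - μ * ν) * ‖x‖ ^ 2 := norm_gradient_step_sq_le hr0 hr1 hf hμ hμδ x
  have h2 : ‖d‖ ^ 2 ≤ δ ^ 2 * P * netSq (disagreement q u) := by
    have hφ : ∀ m, mix (A 1) u m - x = mix (A 1) (disagreement q u) m := fun m => by
      have : disagreement q u = u - fun _ => x := rfl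
      rw [this, map_sub, mix_const (hA.left_stochastic 1)]
      rfl
    calc ‖d‖ ^ 2 ≤ ∑ m, r m * ‖f m (mix (A 1) u m) - f m x‖ ^ 2 :=
          norm_sum_smul_sq_le _ _ _ (fun m _ => hr0 m) hr1.le
      _ ≤ ∑ m, δ ^ 2 * ‖mix (A 1) (disagreement q u) m‖ ^ 2 := by
        refine Finset.sum_le_sum fun m _ => ?_
        have h3 : r m ≤ 1 := hr1 ▸ Finset.single_le_sum (fun p _ => hr0 p) (Finset.mem_univ m)
        refine (mul_le_of_le_one_left (sq_nonneg _) h3).trans ?_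
        have := hf.lipschitz m (mix (A 1) u m) x
        rw [hφ] at this
        rw [← mul_pow]
        gcongr
      _ = δ ^ 2 * netSq (mix (A 1) (disagreement q u)) := by rw [netSq, Finset.mul_sum]
      _ ≤ _ := by
        rw [mul_assoc]
        exact mul_le_mul_of_nonneg_left (netSq_mix_le (hA.left_stochastic 1) _) (sq_nonneg _)
  rw [h0]
  -- Half of the contraction `μ * ν` is spent here, which makes the coupling to the disagreement of
  -- order `μ` instead of `μ ^ 2`.
  have h3 := norm_add_sq_le_of_pos a ((-μ) • d) (t := μ * ν / 2) (by positivity)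
  rw [norm_smul, mul_pow, Real.norm_eq_abs, sq_abs] at h3
  refine h3.trans (add_le_add ?_ ?_)
  · calc (1 + μ * ν / 2) * ‖a‖ ^ 2 ≤ (1 + μ * ν / 2) * ((1 - μ * ν) * ‖x‖ ^ 2) := by gcongr
      _ ≤ _ := by nlinarith [mul_nonneg (sq_nonneg (μ * ν)) (sq_nonneg ‖x‖),
          mul_nonneg (mul_pos hμ hν).le (sq_nonneg ‖x‖)]
  · have h4 : (1 + (μ * ν / 2)⁻¹) * ((-μ) ^ 2 * ‖d‖ ^ 2) = (μ ^ 2 + 2 * μ / ν) * ‖d‖ ^ 2 := by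
      field_simp
    rw [h4]
    gcongr

theorem netSq_field_le (hf : CenteredField (A 2 *ᵥ q) ν δ κ f) (v : Fin P → E) :
    netSq (fun m => f m (v m)) ≤ 2 * δ ^ 2 * netSq v + 2 * (P * κ ^ 2) := by
  have h : (fun m => f m (v m)) = (fun m => f m (v m) - f m 0) + fun m => f m 0 := by
    ext m; simp
  rw [h]
  refine (netSq_add_le _ _).trans (add_le_add ?_ ?_)
  · rw [mul_assoc]
    refine mul_le_mul_of_nonneg_left ?_ zero_le_two
    rw [netSq, netSq, Finset.mul_sum]
    refine Finset.sum_le_sum fun m _ => ?_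
    have := hf.lipschitz m (v m) 0
    rw [sub_zero] at this
    rw [← mul_pow]
    gcongr
  · refine mul_le_mul_of_nonneg_left ?_ zero_le_two
    calc netSq (fun m => f m 0) ≤ ∑ _m : Fin P, κ ^ 2 := Finset.sum_le_sum fun m _ => by
          have := hf.at_zero m
          gcongr
      _ = _ := by simp

theorem netSq_mix_field_le (hA : CombinationPolicy A q)
    (hf : CenteredField (A 2 *ᵥ q) ν δ κ f) (u : Fin P → E) :
    netSq (mix (A 2) fun m => f m (mix (A 1) u m)) ≤
      P * (2 * δ ^ 2 * (P * netSq u) + 2 * (P * κ ^ 2)) := by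
  refine (netSq_mix_le (hA.left_stochastic 2) _).trans
    (mul_le_mul_of_nonneg_left ?_ (Nat.cast_nonneg P))
  refine (netSq_field_le hf _).trans (add_le_add_left ?_ _)
  exact mul_le_mul_of_nonneg_left (netSq_mix_le (hA.left_stochastic 1) _) (by positivity)

/-- Since the contraction `ρ` does not depend on `μ`, Young's inequality costs only the constant `1
+ 2 / ρ`, and the gradient term stays of order `μ ^ 2`. -/
theorem norm_map_driftStep_sq_le {H : Type*} [NormedAddCommGroup H] [InnerProductSpace ℝ H]
    (Ψ : (Fin P → E) →ₗ[ℝ] H) {ρ y z : ℝ} (hρ : 0 < ρ) (hy : 0 ≤ y) (u : Fin P → E)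
    (h₁ : ‖Ψ (mix (A 1 * A 0 * A 2) u)‖ ^ 2 ≤ (1 - ρ) * y)
    (h₂ : ‖Ψ (mix (A 2) fun m => f m (mix (A 1) u m))‖ ^ 2 ≤ z) :
    ‖Ψ (driftStep A μ f u)‖ ^ 2 ≤ (1 - ρ / 2) * y + (1 + 2 / ρ) * (μ ^ 2 * z) := by
  have h : Ψ (driftStep A μ f u) = Ψ (mix (A 1 * A 0 * A 2) u) +
      (-μ) • Ψ (mix (A 2) fun m => f m (mix (A 1) u m)) := by
    rw [driftStep, map_sub, map_smul, neg_smul, sub_eq_add_neg]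
  rw [h]
  refine (norm_add_sq_le_of_pos _ _ (t := ρ / 2) (by positivity)).trans (add_le_add ?_ ?_)
  · calc _ ≤ (1 + ρ / 2) * ((1 - ρ) * y) := mul_le_mul_of_nonneg_left h₁ (by positivity)
      _ ≤ _ := by nlinarith [mul_nonneg hρ.le hy, mul_nonneg (sq_nonneg ρ) hy]
  · rw [norm_smul, mul_pow, Real.norm_eq_abs, sq_abs, neg_sq, inv_div]
    gcongr

/-- Here `x` is the mean part and `y` the disagreement part. The coupling `μ * G * y` is absorbed by
the fast rate `ρ / 2`, and the feedback `b * μ ^ 2 * x` by half of the slow rate `μ * ν / 2`. -/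
theorem lyapunov_step_arith {x y x' y' μ ν ρ G b : ℝ} (hx : 0 ≤ x) (hy : 0 ≤ y) (hμ : 0 < μ)
    (hμ1 : μ < 1) (hb : 0 ≤ b) (hμb : μ * (b + 1) < ν / 4)
    (hμG : μ * (ν / 4 + G + b + 1) < ρ / 2)
    (hx' : x' ≤ (1 - μ * ν / 2) * x + μ * G * y)
    (hy' : y' ≤ (1 - ρ / 2) * y + b * μ ^ 2 * (x + y + 1)) :
    x' + y' ≤ (1 - ν / 4 * μ) * (x + y) + b * μ ^ 2 := by
  have e0 : μ * (μ * (b + 1)) ≤ μ * (ν / 4) := mul_le_mul_of_nonneg_left hμb.le hμ.le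
  have e1 : b * μ ^ 2 ≤ ν / 4 * μ := by nlinarith
  have e2 : μ * G + b * μ ^ 2 + ν / 4 * μ ≤ ρ / 2 := by
    have : b * μ ^ 2 ≤ b * μ := mul_le_mul_of_nonneg_left (by nlinarith) hb
    nlinarith
  have e3 := mul_le_mul_of_nonneg_right e1 hx
  have e4 := mul_le_mul_of_nonneg_right e2 hy
  nlinarith

/-- A linear map `Φ` of the network vectors to a Euclidean space `H`, whose squared norm is
equivalent to that of the network vectors, and is contracted by the noiseless iteration up to a
drift of second order in the step-size. -/
theorem exists_drift_lyapunov (hA : CombinationPolicy A q) (hν : 0 < ν) (hδ : 0 < δ) (κ : ℝ)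
    (E : Type) [NormedAddCommGroup E] [InnerProductSpace ℝ E] [FiniteDimensional ℝ E] :
    ∃ (H : Type) (_ : NormedAddCommGroup H) (_ : InnerProductSpace ℝ H)
      (_ : FiniteDimensional ℝ H) (Φ : (Fin P → E) →ₗ[ℝ] H) (a μ₁ C₁ k₁ k₂ : ℝ),
      0 < a ∧ 0 < μ₁ ∧ 0 ≤ C₁ ∧ 0 ≤ k₁ ∧ 0 ≤ k₂ ∧
      (∀ u, netSq u ≤ k₁ * ‖Φ u‖ ^ 2) ∧ (∀ u, ‖Φ u‖ ^ 2 ≤ k₂ * netSq u) ∧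
      ∀ μ, 0 < μ → μ < μ₁ → ∀ f : Fin P → E → E, CenteredField (A 2 *ᵥ q) ν δ κ f → ∀ u,
        ‖Φ (driftStep A μ f u)‖ ^ 2 ≤ (1 - a * μ) * ‖Φ u‖ ^ 2 + C₁ * μ ^ 2 := by
  have hq0 : ∀ p, 0 ≤ q p := fun p => (hA.perron_pos p).le
  obtain ⟨K, ρ, k₁, k₂, hρ, hk₁, hk₂, h⟩ := exists_disagreement_lyapunov hA.product_mem
    hA.primitive hA.perron_pos hA.perron_sum hA.perron_eq E
  set Ψ : (Fin P → E) →ₗ[ℝ] PiLp 2 (fun _ : Fin K × Fin P => E) :=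
    disagreementOrbit (A 1 * A 0 * A 2) q K with hΨ
  set Φ : (Fin P → E) →ₗ[ℝ] WithLp 2 (E × PiLp 2 (fun _ : Fin K × Fin P => E)) :=
    (WithLp.linearEquiv 2 ℝ _).symm.toLinearMap ∘ₗ (centroid q).prod Ψ with hΦ
  have hΦsq : ∀ u, ‖Φ u‖ ^ 2 = ‖centroid q u‖ ^ 2 + ‖Ψ u‖ ^ 2 := fun u =>
    WithLp.prod_norm_sq_eq_of_L2 _
  have hnet : ∀ u : Fin P → E,
      netSq u ≤ 2 * (P * ‖centroid q u‖ ^ 2) + 2 * (k₁ * ‖Ψ u‖ ^ 2) := fun u =>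
    (netSq_le_centroid_add_disagreement q u).trans (by linarith [(h u).2.1])
  set b : ℝ := (1 + 2 / ρ) * (k₂ * (P * (2 * δ ^ 2 * (P * (2 * P + 2 * k₁)) + 2 * (P * κ ^ 2))))
    with hb
  have hb0 : 0 ≤ b := by positivity
  set G : ℝ := (1 + 2 / ν) * (δ ^ 2 * P * k₁) with hG
  have hG0 : 0 ≤ G := by positivity
  -- The bound `ν / δ ^ 2` on `μ` is needed for the gradient step; the other three are the smallness
  -- conditions of `lyapunov_step_arith`.
  refine ⟨_, inferInstance, inferInstance, inferInstance, Φ, ν / 4,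
    min (min 1 (ν / δ ^ 2)) (min (ν / 4 / (b + 1)) (ρ / 2 / (ν / 4 + G + b + 1))), b,
    2 * P + 2 * k₁, 1 + k₂, by positivity, by positivity, hb0, by positivity, by positivity,
    fun u => ?_, fun u => ?_, fun μ hμ hμ1 f hf u => ?_⟩
  · rw [hΦsq]
    have := hnet u
    have h1 : 0 ≤ k₁ * ‖centroid q u‖ ^ 2 := by positivity
    have h2 : 0 ≤ P * ‖Ψ u‖ ^ 2 := by positivity
    nlinarith
  · rw [hΦsq]
    linarith [(h u).2.2, norm_centroid_sq_le hq0 hA.perron_sum u]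
  · simp only [lt_min_iff] at hμ1
    obtain ⟨⟨hμ1, hμδ⟩, hμb, hμG⟩ := hμ1
    rw [lt_div_iff₀ (by positivity)] at hμδ hμb hμG
    set x := ‖centroid q u‖ ^ 2 with hx
    set y := ‖Ψ u‖ ^ 2 with hy
    have hx0 : 0 ≤ x := sq_nonneg _
    have hy0 : 0 ≤ y := sq_nonneg _
    have hc : ‖centroid q (driftStep A μ f u)‖ ^ 2 ≤ (1 - μ * ν / 2) * x + μ * G * y := by
      refine (norm_centroid_driftStep_sq_le hA hf hν hμ hμδ.le u).trans ?_
      have h1 : netSq (disagreement q u) ≤ k₁ * y := (h u).2.1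
      have h2 : μ ^ 2 + 2 * μ / ν ≤ μ * (1 + 2 / ν) := by
        have : μ * (1 + 2 / ν) = μ + 2 * μ / ν := by ring
        rw [this]
        nlinarith
      have h3 : (μ ^ 2 + 2 * μ / ν) * (δ ^ 2 * P * netSq (disagreement q u)) ≤
          μ * (1 + 2 / ν) * (δ ^ 2 * P * (k₁ * y)) := by
        have := netSq_nonneg (disagreement q u)
        gcongr
      have h4 : μ * (1 + 2 / ν) * (δ ^ 2 * P * (k₁ * y)) = μ * G * y := by rw [hG]; ring
      linarith
    have hd : ‖Ψ (driftStep A μ f u)‖ ^ 2 ≤ (1 - ρ / 2) * y + b * μ ^ 2 * (x + y + 1) := by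
      have h1 : netSq u ≤ (2 * P + 2 * k₁) * (x + y + 1) := by
        have h5 := hnet u
        have h6 : 0 ≤ k₁ * x := mul_nonneg hk₁ hx0
        have h7 : 0 ≤ P * y := mul_nonneg (Nat.cast_nonneg P) hy0
        have h8 : (0 : ℝ) ≤ P := Nat.cast_nonneg P
        linarith
      -- The summand `1` in `x + y + 1` carries the constant contribution of the gradients at the
      -- origin.
      have h2 : 2 * (P * κ ^ 2) ≤ 2 * (P * κ ^ 2) * (x + y + 1) :=
        le_mul_of_one_le_right (by positivity) (by linarith)
      have h3 : ‖Ψ (mix (A 2) fun m => f m (mix (A 1) u m))‖ ^ 2 ≤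
          k₂ * (P * (2 * δ ^ 2 * (P * ((2 * P + 2 * k₁) * (x + y + 1))) +
            2 * (P * κ ^ 2) * (x + y + 1))) := by
        refine ((h _).2.2.trans (mul_le_mul_of_nonneg_left (netSq_mix_field_le hA hf u) hk₂)).trans ?_
        gcongr
      refine (norm_map_driftStep_sq_le Ψ hρ hy0 u (h u).1 h3).trans_eq ?_
      rw [hb]
      ring
    rw [hΦsq, hΦsq]
    exact lyapunov_step_arith hx0 hy0 hμ hμ1 hb0 hμb hμG hc hd

end Drift

/-! ### Gradients of the risks. -/

namespace LearningProblem

variable {P M : ℕ} {X : Type*} {L : LearningProblem P M X} {ν δ : ℝ}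

theorem ConvexSmooth.hasGradientAt_risk (hL : L.ConvexSmooth ν δ) (p : Fin P) (w : Vec M) :
    HasGradientAt (L.risk p)
      ((1 / (L.N p : ℝ)) • ∑ n, gradient (fun w => L.Q p w (L.x p n)) w) w := by
  rw [hasGradientAt_iff_hasFDerivAt, map_smul, map_sum]
  exact (HasFDerivAt.fun_sum fun n _ =>
    ((hL.differentiable p n) w).hasGradientAt.hasFDerivAt).const_mul _

theorem ConvexSmooth.differentiable_risk (hL : L.ConvexSmooth ν δ) (p : Fin P) :
    Differentiable ℝ (L.risk p) := fun w => (hL.hasGradientAt_risk p w).differentiableAt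

theorem ConvexSmooth.lipschitz_gradient_risk (hL : L.ConvexSmooth ν δ) (hδ : 0 ≤ δ) (p : Fin P)
    (x y : Vec M) : ‖gradient (L.risk p) x - gradient (L.risk p) y‖ ≤ δ * ‖x - y‖ := by
  rw [(hL.hasGradientAt_risk p x).gradient, (hL.hasGradientAt_risk p y).gradient, ← smul_sub,
    ← Finset.sum_sub_distrib, norm_smul, Real.norm_of_nonneg (by positivity)]
  calc _ ≤ 1 / (L.N p : ℝ) * ∑ _n : Fin (L.N p), δ * ‖x - y‖ := by
        gcongr
        exact (norm_sum_le _ _).trans (Finset.sum_le_sum fun n _ => hL.lipschitz p n y x)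
    _ = (1 / (L.N p : ℝ) * L.N p) * (δ * ‖x - y‖) := by simp [mul_assoc]
    _ ≤ _ := by
      refine mul_le_of_le_one_left (by positivity) ?_
      -- The product of `N` and its inverse is one, or zero for an agent without data, as `0⁻¹ = 0`.
      rw [one_div]
      exact inv_mul_le_one

theorem ConvexSmooth.monotone_gradient_risk (hL : L.ConvexSmooth ν δ) (p : Fin P) (x y : Vec M) :
    ν * ‖x - y‖ ^ 2 ≤ inner ℝ (gradient (L.risk p) x - gradient (L.risk p) y) (x - y) := by
  have h1 := hL.strongly_convex p x y
  have h2 := hL.strongly_convex p y x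
  rw [← neg_sub x y, norm_neg, inner_neg_right] at h1
  rw [inner_sub_left]
  linarith

theorem gradient_eq_zero_of_isMinOn {F : Vec M → ℝ} {w : Vec M} (h : IsMinOn F Set.univ w) :
    gradient F w = 0 := by
  have : fderiv ℝ F w = 0 := (h.isLocalMin univ_mem).fderiv_eq_zero
  simp [gradient, this]

/-- The gradient of `J_p` vanishes at its own minimizer, which lies within `ξ` of `wo`; this gives
the size `δ * ξ` at `wo`. Balance is the first-order condition for the weighted cost. -/
theorem ConvexSmooth.centeredField (hL : L.ConvexSmooth ν δ) (hδ : 0 ≤ δ) {ξ : ℝ} {wo : Vec M}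
    {wloc : Fin P → Vec M} (hd : L.ModelDrift ξ wo wloc) {r : Fin P → ℝ}
    (hr : IsMinOn (L.weightedAggregate r) Set.univ wo) :
    CenteredField r ν δ (δ * ξ) fun p x => gradient (L.risk p) (wo + x) where
  lipschitz p x y := by simpa using hL.lipschitz_gradient_risk hδ p (wo + x) (wo + y)
  monotone p x y := by simpa using hL.monotone_gradient_risk p (wo + x) (wo + y)
  at_zero p := by
    have h := hL.lipschitz_gradient_risk hδ p wo (wloc p)
    rw [gradient_eq_zero_of_isMinOn (hd.local_min p), sub_zero] at h
    rw [add_zero]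
    exact h.trans (mul_le_mul_of_nonneg_left (hd.drift p) hδ)
  balanced := by
    have h : HasGradientAt (L.weightedAggregate r) (∑ p, r p • gradient (L.risk p) wo) wo := by
      rw [hasGradientAt_iff_hasFDerivAt, map_sum]
      simp only [map_smul]
      exact HasFDerivAt.fun_sum fun p _ =>
        ((hL.differentiable_risk p) wo).hasGradientAt.hasFDerivAt.const_mul _
    simp only [add_zero]
    rw [← h.gradient, gradient_eq_zero_of_isMinOn hr]

end LearningProblem

/-! ### Moments of the Laplace distribution. -/

section Laplace

variable {b : ℝ}

theorem integral_laplaceMeasure (hb : 0 < b) (F : ℝ → ℝ) :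
    ∫ x, F x ∂laplaceMeasure b = ∫ x, 1 / (2 * b) * Real.exp (-|x| / b) * F x := by
  rw [laplaceMeasure, integral_withDensity_eq_integral_toReal_smul (by fun_prop)
    (Eventually.of_forall fun _ => ENNReal.ofReal_lt_top)]
  refine integral_congr_ae (Eventually.of_forall fun x => ?_)
  simp only [smul_eq_mul]
  rw [ENNReal.toReal_ofReal (by positivity)]

theorem integral_id_laplaceMeasure (hb : 0 < b) : ∫ x, x ∂laplaceMeasure b = 0 := by
  rw [integral_laplaceMeasure hb fun x => x]
  have h := integral_neg_eq_self (fun x : ℝ => 1 / (2 * b) * Real.exp (-|x| / b) * x) volume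
  simp only [abs_neg, mul_neg, integral_neg] at h
  linarith

theorem integral_sq_laplaceMeasure (hb : 0 < b) : ∫ x, x ^ 2 ∂laplaceMeasure b = 2 * b ^ 2 := by
  rw [integral_laplaceMeasure hb fun x => x ^ 2]
  -- Evenness reduces the integral to the half-line, where it is a Gamma integral with `Γ(3) = 2`.
  have h1 := integral_comp_abs (f := fun x : ℝ => 1 / (2 * b) * Real.exp (-x / b) * x ^ 2)
  simp only [sq_abs] at h1
  have h2 := Real.integral_rpow_mul_exp_neg_mul_Ioi (a := 3) (r := 1 / b) (by norm_num)
    (by positivity)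
  have h3 : Real.Gamma 3 = 2 := by simp
  have h4 : ∫ x in Set.Ioi (0 : ℝ), 1 / (2 * b) * Real.exp (-x / b) * x ^ 2 =
      1 / (2 * b) * ∫ x in Set.Ioi (0 : ℝ), x ^ ((3 : ℝ) - 1) * Real.exp (-(1 / b * x)) := by
    rw [← integral_const_mul]
    refine integral_congr_ae (Eventually.of_forall fun x => ?_)
    have e1 : (3 : ℝ) - 1 = ((2 : ℕ) : ℝ) := by norm_num
    have e2 : -(1 / b * x) = -x / b := by ring
    simp only [e1, e2, Real.rpow_natCast]
    ring
  rw [h1, h4, h2, h3]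
  have e : (1 / (1 / b)) ^ (3 : ℝ) = b ^ 3 := by
    rw [one_div_one_div, show (3 : ℝ) = ((3 : ℕ) : ℝ) by norm_num, Real.rpow_natCast]
  rw [e]
  field_simp

/-- The integral of a nonintegrable function is zero by convention, whereas this one is known to be
positive. -/
theorem integrable_sq_laplaceMeasure (hb : 0 < b) :
    Integrable (fun x => x ^ 2) (laplaceMeasure b) := by
  by_contra h
  have h1 := integral_sq_laplaceMeasure hb
  rw [integral_undef h] at h1
  have : 0 < 2 * b ^ 2 := by positivity
  linarith

variable {Ω : Type*} [MeasurableSpace Ω] {Pr : Measure Ω} {M : ℕ} {g : Ω → Vec M}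

theorem measurable_coord (hg : Measurable g) (k : Fin M) : Measurable fun ω => g ω k := by
  fun_prop

theorem memLp_of_map_eq_laplaceMeasure (hb : 0 < b) (hg : Measurable g)
    (h : ∀ k, Measure.map (fun ω => g ω k) Pr = laplaceMeasure b) : MemLp g 2 Pr := by
  refine MemLp.of_eval_piLp fun k => ?_
  have hk := measurable_coord hg k
  rw [memLp_two_iff_integrable_sq hk.aestronglyMeasurable]
  have h1 := integrable_sq_laplaceMeasure hb
  rw [← h k] at h1
  exact h1.comp_measurable hk

theorem integral_of_map_eq_laplaceMeasure (hb : 0 < b) (hg : Measurable g) (hgi : Integrable g Pr)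
    (h : ∀ k, Measure.map (fun ω => g ω k) Pr = laplaceMeasure b) : ∫ ω, g ω ∂Pr = 0 := by
  ext k
  have h1 : ∫ x, x ∂Measure.map (fun ω => g ω k) Pr = ∫ ω, g ω k ∂Pr :=
    integral_map (measurable_coord hg k).aemeasurable aestronglyMeasurable_id
  rw [eval_integral_piLp fun k => hgi.eval_piLp k, PiLp.zero_apply, ← h1, h k,
    integral_id_laplaceMeasure hb]

theorem integral_norm_sq_of_map_eq_laplaceMeasure (hb : 0 < b) (hg : Measurable g)
    (h : ∀ k, Measure.map (fun ω => g ω k) Pr = laplaceMeasure b) :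
    ∫ ω, ‖g ω‖ ^ 2 ∂Pr = M * (2 * b ^ 2) := by
  have h1 : ∀ k, ∫ ω, g ω k ^ 2 ∂Pr = 2 * b ^ 2 := fun k => by
    rw [← integral_sq_laplaceMeasure hb, ← h k,
      integral_map (measurable_coord hg k).aemeasurable (by fun_prop)]
  have h2 := memLp_of_map_eq_laplaceMeasure hb hg h
  simp only [EuclideanSpace.real_norm_sq_eq]
  rw [integral_finsetSum _ fun k _ => (h2.eval_piLp k).integrable_sq]
  simp [h1]

end Laplace

/-! ### Orthogonality of martingale differences. -/

section Conditional

variable {Ω : Type*} {m m0 : MeasurableSpace Ω} {Pr : Measure Ω} [IsProbabilityMeasure Pr]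
  {H : Type*} [NormedAddCommGroup H] [InnerProductSpace ℝ H]

theorem integrable_norm_sq {H : Type*} [NormedAddCommGroup H] {X : Ω → H} (hX : MemLp X 2 Pr) :
    Integrable (fun ω => ‖X ω‖ ^ 2) Pr :=
  (memLp_two_iff_integrable_sq_norm hX.aestronglyMeasurable).1 hX

theorem integrable_inner_of_memLp_two {X Y : Ω → H} (hX : MemLp X 2 Pr) (hY : MemLp Y 2 Pr) :
    Integrable (fun ω => inner ℝ (X ω) (Y ω)) Pr := by
  refine ((integrable_norm_sq hX).add (integrable_norm_sq hY)).mono'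
    (hX.aestronglyMeasurable.inner hY.aestronglyMeasurable) (Eventually.of_forall fun ω => ?_)
  refine (norm_inner_le_norm _ _).trans ?_
  simp only [Pi.add_apply]
  nlinarith [sq_nonneg (‖X ω‖ - ‖Y ω‖), sq_nonneg (‖X ω‖), sq_nonneg (‖Y ω‖)]

/-- The `m`-measurable factor is pulled out of the conditional expectation: `E⟨X, Z⟩ = E⟨X, E[Z |
m]⟩`. -/
theorem integral_inner_eq_zero_of_condExp [CompleteSpace H] (hm : m ≤ m0) {X Z : Ω → H}
    (hX : StronglyMeasurable[m] X) (hX2 : MemLp X 2 Pr) (hZ2 : MemLp Z 2 Pr)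
    (hZ : Pr[Z | m] =ᵐ[Pr] 0) : ∫ ω, inner ℝ (X ω) (Z ω) ∂Pr = 0 := by
  have h := condExp_bilin_of_stronglyMeasurable_left (innerSL ℝ) hX
    (integrable_inner_of_memLp_two hX2 hZ2) (hZ2.integrable one_le_two)
  refine (integral_condExp (f := fun ω => inner ℝ (X ω) (Z ω)) hm).symm.trans ?_
  refine (integral_congr_ae h).trans ?_
  refine integral_eq_zero_of_ae ?_
  filter_upwards [hZ] with ω hω
  simp [hω]

/-- A martingale-difference perturbation `Z` enters the second moment additively, and an
arbitrary perturbation `Y` at the price of a factor `1 + t`. -/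
theorem integral_norm_sq_add_add_le [CompleteSpace H] (hm : m ≤ m0) {X Y Z : Ω → H} {t : ℝ}
    (ht : 0 < t) (hX : StronglyMeasurable[m] X) (hX2 : MemLp X 2 Pr) (hY2 : MemLp Y 2 Pr)
    (hZ2 : MemLp Z 2 Pr) (hZ : Pr[Z | m] =ᵐ[Pr] 0) :
    ∫ ω, ‖X ω + Y ω + Z ω‖ ^ 2 ∂Pr ≤ (1 + t) * ∫ ω, ‖X ω‖ ^ 2 ∂Pr +
      (2 + t⁻¹) * ∫ ω, ‖Y ω‖ ^ 2 ∂Pr + 2 * ∫ ω, ‖Z ω‖ ^ 2 ∂Pr := by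
  -- Only the product of `X` and `Z` is kept exactly. That of `Y` and `Z`, which may be correlated,
  -- is split by `2⟨Y, Z⟩ ≤ ‖Y‖² + ‖Z‖²`, whence the coefficients `2 + t⁻¹` and `2`.
  have hpt : ∀ ω, ‖X ω + Y ω + Z ω‖ ^ 2 ≤ (1 + t) * ‖X ω‖ ^ 2 + (2 + t⁻¹) * ‖Y ω‖ ^ 2 +
      2 * ‖Z ω‖ ^ 2 + 2 * inner ℝ (X ω) (Z ω) := fun ω => by
    have h1 := norm_add_sq_le_of_pos (X ω) (Y ω) ht
    have h2 := norm_add_sq_real (X ω + Y ω) (Z ω)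
    rw [inner_add_left] at h2
    have h3 := real_inner_le_norm (Y ω) (Z ω)
    nlinarith [sq_nonneg (‖Y ω‖ - ‖Z ω‖)]
  have iX := (integrable_norm_sq hX2).const_mul (1 + t)
  have iY := (integrable_norm_sq hY2).const_mul (2 + t⁻¹)
  have iZ := (integrable_norm_sq hZ2).const_mul 2
  have iI := (integrable_inner_of_memLp_two hX2 hZ2).const_mul 2
  refine (integral_mono (integrable_norm_sq ((hX2.add hY2).add hZ2))
    (((iX.add iY).add iZ).add iI) hpt).trans_eq ?_
  rw [integral_add' ((iX.add iY).add iZ) iI, integral_add' (iX.add iY) iZ, integral_add' iX iY]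
  simp only [integral_const_mul]
  rw [integral_inner_eq_zero_of_condExp hm hX hX2 hZ2 hZ]
  ring

end Conditional

/-! ### Square-integrability and conditional means under linear maps. -/

section RandomVectors

variable {Ω : Type*} {m m0 : MeasurableSpace Ω} {Pr : Measure Ω} [IsProbabilityMeasure Pr]
  {U V : Type*} [NormedAddCommGroup U] [NormedSpace ℝ U] [FiniteDimensional ℝ U]
  [NormedAddCommGroup V] [NormedSpace ℝ V]

theorem memLp_linearMap_comp (T : U →ₗ[ℝ] V) {X : Ω → U} (hX : MemLp X 2 Pr) :
    MemLp (fun ω => T (X ω)) 2 Pr :=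
  (LinearMap.toContinuousLinearMap T).comp_memLp' hX

theorem condExp_linearMap_comp_eq_zero [CompleteSpace V] (T : U →ₗ[ℝ] V) {X : Ω → U}
    (hX : Integrable X Pr) (h : Pr[X | m] =ᵐ[Pr] 0) :
    Pr[fun ω => T (X ω) | m] =ᵐ[Pr] 0 := by
  have : CompleteSpace U := FiniteDimensional.complete ℝ U
  have h1 := (LinearMap.toContinuousLinearMap T).comp_condExp_comm (m := m) hX
  refine EventuallyEq.trans (show Pr[fun ω => T (X ω) | m] =ᵐ[Pr] _ from h1.symm) ?_
  filter_upwards [h] with ω hω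
  simp [hω]

theorem condExp_add_eq_zero [CompleteSpace V] {X Y : Ω → V} (hX : Integrable X Pr) (hY : Integrable Y Pr)
    (hX0 : Pr[X | m] =ᵐ[Pr] 0) (hY0 : Pr[Y | m] =ᵐ[Pr] 0) :
    Pr[fun ω => X ω + Y ω | m] =ᵐ[Pr] 0 := by
  refine EventuallyEq.trans (show Pr[fun ω => X ω + Y ω | m] =ᵐ[Pr] _ from condExp_add hX hY m) ?_
  filter_upwards [hX0, hY0] with ω h1 h2
  simp [h1, h2]

theorem condExp_pi_eq_zero {ι : Type*} [Fintype ι] [CompleteSpace V] {X : Ω → ι → V}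
    (hX : Integrable X Pr) (h : ∀ i, Pr[fun ω => X ω i | m] =ᵐ[Pr] 0) :
    Pr[X | m] =ᵐ[Pr] 0 := by
  have h1 : ∀ i, ∀ᵐ ω ∂Pr, Pr[X | m] ω i = 0 := fun i => by
    filter_upwards [(ContinuousLinearMap.proj (R := ℝ) (φ := fun _ : ι => V) i).comp_condExp_comm
      (m := m) hX, h i] with ω h2 h3
    exact h2.trans h3
  filter_upwards [ae_all_iff.2 h1] with ω hω
  exact funext hω

end RandomVectors

/-! ### Gradient fields and mixed noise along random network vectors. -/

section Field

variable {P : ℕ} {E : Type*} [NormedAddCommGroup E] [InnerProductSpace ℝ E]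
  {r : Fin P → ℝ} {ν δ κ : ℝ} {f : Fin P → E → E}

theorem CenteredField.continuous (hf : CenteredField r ν δ κ f) (p : Fin P) : Continuous (f p) :=
  (LipschitzWith.of_dist_le' fun x y => by
    rw [dist_eq_norm, dist_eq_norm]; exact hf.lipschitz p x y).continuous

theorem CenteredField.continuous_pi (hf : CenteredField r ν δ κ f) :
    Continuous fun (v : Fin P → E) (p : Fin P) => f p (v p) :=
  _root_.continuous_pi fun p => (hf.continuous p).comp (continuous_apply p)

theorem continuous_mix (A : Matrix (Fin P) (Fin P) ℝ) :
    Continuous fun u : Fin P → E => mix A u := by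
  refine _root_.continuous_pi fun p => ?_
  simp only [mix_apply]
  fun_prop

theorem CenteredField.continuous_driftStep (hf : CenteredField r ν δ κ f)
    (A : Fin 3 → Matrix (Fin P) (Fin P) ℝ) (μ : ℝ) : Continuous (driftStep A μ f) :=
  (continuous_mix _).sub (((continuous_mix _).comp
    (hf.continuous_pi.comp (continuous_mix _))).const_smul μ)

variable {Ω : Type*} {m0 : MeasurableSpace Ω} {Pr : Measure Ω} [IsProbabilityMeasure Pr]

theorem CenteredField.memLp_comp (hf : CenteredField r ν δ κ f) {v : Ω → Fin P → E}
    (hv : MemLp v 2 Pr) : MemLp (fun ω p => f p (v ω p)) 2 Pr := by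
  refine MemLp.of_eval fun p => ?_
  have h0 : MemLp (fun ω => δ * ‖v ω p‖) 2 Pr := (hv.eval p).norm.const_mul δ
  have h1 : MemLp (fun ω => ‖f p 0‖ + δ * ‖v ω p‖) 2 Pr := (memLp_const ‖f p 0‖).add h0
  refine h1.mono ((hf.continuous p).comp_aestronglyMeasurable (hv.eval p).aestronglyMeasurable)
    (Eventually.of_forall fun ω => ?_)
  have h2 := hf.lipschitz p (v ω p) 0
  rw [sub_zero] at h2
  have h3 : ‖f p (v ω p)‖ ≤ ‖f p 0‖ + ‖f p (v ω p) - f p 0‖ := by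
    simpa using norm_add_le (f p 0) (f p (v ω p) - f p 0)
  exact (h3.trans (by linarith)).trans (le_abs_self _)

theorem CenteredField.memLp_driftStep [FiniteDimensional ℝ E] (hf : CenteredField r ν δ κ f)
    (A : Fin 3 → Matrix (Fin P) (Fin P) ℝ) (μ : ℝ) {v : Ω → Fin P → E} (hv : MemLp v 2 Pr) :
    MemLp (fun ω => driftStep A μ f (v ω)) 2 Pr :=
  (memLp_linearMap_comp _ hv).sub
    ((memLp_linearMap_comp _ (hf.memLp_comp (memLp_linearMap_comp _ hv))).const_smul μ)

theorem integrable_netSq {v : Ω → Fin P → E} (hv : MemLp v 2 Pr) :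
    Integrable (fun ω => netSq (v ω)) Pr :=
  integrable_finsetSum _ fun p _ => integrable_norm_sq (hv.eval p)

/-- The combination of the noises added to the messages. -/
def noiseMix (A : Matrix (Fin P) (Fin P) ℝ) : (Fin P → Fin P → E) →ₗ[ℝ] (Fin P → E) where
  toFun g p := ∑ m, A m p • g m p
  map_add' u v := by ext p; simp [Finset.sum_add_distrib]
  map_smul' c u := by
    ext p
    simp only [Pi.smul_apply, RingHom.id_apply, Finset.smul_sum]
    exact Finset.sum_congr rfl fun m _ => smul_comm _ _ _

theorem integral_netSq_noiseMix_le [FiniteDimensional ℝ E] {A : Matrix (Fin P) (Fin P) ℝ}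
    (hA : A ∈ Matrix.colStochastic ℝ (Fin P)) {g : Ω → Fin P → Fin P → E} (hg : MemLp g 2 Pr)
    {s : ℝ} (hs : ∀ m p, ∫ ω, ‖g ω m p‖ ^ 2 ∂Pr = s) :
    ∫ ω, netSq (noiseMix A (g ω)) ∂Pr ≤ P * s := by
  have hi : ∀ m p, Integrable (fun ω => A m p * ‖g ω m p‖ ^ 2) Pr := fun m p =>
    (integrable_norm_sq ((hg.eval m).eval p)).const_mul _
  calc ∫ ω, netSq (noiseMix A (g ω)) ∂Pr ≤ ∫ ω, ∑ p, ∑ m, A m p * ‖g ω m p‖ ^ 2 ∂Pr := by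
        refine integral_mono (integrable_netSq (memLp_linearMap_comp _ hg))
          (integrable_finsetSum _ fun p _ => integrable_finsetSum _ fun m _ => hi m p) fun ω => ?_
        exact Finset.sum_le_sum fun p _ => norm_sum_smul_sq_le _ _ _
          (fun _ _ => Matrix.nonneg_of_mem_colStochastic hA)
          (Matrix.sum_col_of_mem_colStochastic hA p).le
    _ = ∑ p, ∑ m, A m p * s := by
      rw [integral_finsetSum _ fun p _ => integrable_finsetSum _ fun m _ => hi m p]
      refine Finset.sum_congr rfl fun p _ => ?_
      rw [integral_finsetSum _ fun m _ => hi m p]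
      refine Finset.sum_congr rfl fun m _ => ?_
      rw [integral_const_mul, hs]
    _ = P * s := by
      simp only [← Finset.sum_mul, Matrix.sum_col_of_mem_colStochastic hA]
      simp

end Field

/-! ### The error recursion. -/

namespace RandomInputs

variable {P M : ℕ} {Ω : Type*} (R : RandomInputs P M Ω)
  (A : Fin 3 → Matrix (Fin P) (Fin P) ℝ) (μ : ℝ) {X : Type*} (L : LearningProblem P M X)
  (wo : Vec M)

/-- The network error `col {w_{p,i} - wo}`. -/
def err (i : ℕ) (ω : Ω) : Fin P → Vec M := fun p => R.model A μ i p ω - wo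

/-- The combined noise of stage `j`. -/
def stageNoise (i : ℕ) (j : Fin 3) (ω : Ω) : Fin P → Vec M :=
  noiseMix (A j) fun m p => R.g i j m p ω

/-- The part of the perturbation which has mean zero given the past. -/
def centeredNoise (i : ℕ) (ω : Ω) : Fin P → Vec M :=
  mix (A 2) (mix (A 0) (R.stageNoise A i 1 ω)) + mix (A 2) (R.stageNoise A i 0 ω) +
    R.stageNoise A i 2 ω + mix (A 2) (-μ • fun p => R.gradNoise A μ L i p ω)

/-- The change of the gradient step which is caused by the noise in the pre-combined models. -/
def gradShift (f : Fin P → Vec M → Vec M) (i : ℕ) (ω : Ω) : Fin P → Vec M :=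
  mix (A 2) (-μ • fun p => f p (mix (A 1) (R.err A μ wo i ω) p + R.stageNoise A i 1 ω p) -
    f p (mix (A 1) (R.err A μ wo i ω) p))

theorem combine_eq (B : Matrix (Fin P) (Fin P) ℝ) (u : Fin P → Vec M)
    (g : Fin P → Fin P → Vec M) : combine B u g = mix B u + noiseMix B g := by
  ext1 p
  simp only [combine, smul_add, Finset.sum_add_distrib]
  rfl

variable {A} {q : Fin P → ℝ}

theorem preModel_eq (hA : CombinationPolicy A q) (i : ℕ) (ω : Ω) :
    (fun p => R.preModel A μ i p ω) =
      fun p => wo + (mix (A 1) (R.err A μ wo i ω) p + R.stageNoise A i 1 ω p) := by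
  have h : (fun m => R.model A μ i m ω) = (fun _ => wo) + R.err A μ wo i ω := by
    ext1 m; simp [err]
  have h1 : (fun p => R.preModel A μ i p ω) = combine (A 1) (fun m => R.model A μ i m ω)
      fun m p => R.g i 1 m p ω := rfl
  rw [h1, combine_eq, h, map_add, mix_const (hA.left_stochastic 1)]
  ext1 p
  simp only [Pi.add_apply, add_assoc]
  rfl

/-- The gradient at the noisy pre-combined model is split into its value at the noiseless mixture,
which is determined by the past, and a remainder caused by the noise. The constant `wo` passes
through every combination because columns add up to one. -/
theorem err_succ (hA : CombinationPolicy A q) (i : ℕ) (ω : Ω) :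
    R.err A μ wo (i + 1) ω =
      driftStep A μ (fun p x => gradient (L.risk p) (wo + x)) (R.err A μ wo i ω) +
        R.gradShift A μ wo (fun p x => gradient (L.risk p) (wo + x)) i ω +
        R.centeredNoise A μ L i ω := by
  set φ : Fin P → Vec M := fun p => R.preModel A μ i p ω with hφ
  have hφ' := R.preModel_eq μ wo hA i ω
  set ψ : Fin P → Vec M := mix (A 0) φ + R.stageNoise A i 0 ω -
    μ • fun p => R.gradHat i p ω (φ p) with hψ
  have h1 : (fun p => R.model A μ (i + 1) p ω) = mix (A 2) ψ + R.stageNoise A i 2 ω := by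
    have e : (fun p => R.model A μ (i + 1) p ω) = combine (A 2)
      (fun p => combine (A 0) φ (fun m p => R.g i 0 m p ω) p - μ • R.gradHat i p ω (φ p))
      (fun m p => R.g i 2 m p ω) := rfl
    rw [e, combine_eq, combine_eq]
    rfl
  have h2 : (fun p => R.gradHat i p ω (φ p)) = (fun p => R.gradNoise A μ L i p ω) +
      fun p => gradient (L.risk p) (φ p) := by
    ext1 p; simp [gradNoise, hφ]
  have h3 : R.err A μ wo (i + 1) ω = (fun p => R.model A μ (i + 1) p ω) - fun _ => wo := rfl
  have h4 : φ = (fun _ => wo) + (mix (A 1) (R.err A μ wo i ω) + R.stageNoise A i 1 ω) := hφ'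
  have h5 : (fun p => gradient (L.risk p) (φ p)) =
      (fun p => gradient (L.risk p) (wo + mix (A 1) (R.err A μ wo i ω) p)) +
      fun p => gradient (L.risk p) (wo + (mix (A 1) (R.err A μ wo i ω) p +
        R.stageNoise A i 1 ω p)) -
        gradient (L.risk p) (wo + mix (A 1) (R.err A μ wo i ω) p) := by
    ext1 p
    simp [congrFun hφ' p, φ]
  rw [h3, h1, hψ, h2, h5, h4]
  simp only [map_add, map_sub, map_smul, mix_const (hA.left_stochastic 0),
    mix_const (hA.left_stochastic 2), smul_add, driftStep, gradShift, centeredNoise, mix_mix,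
    neg_smul, map_neg]
  abel

end RandomInputs

/-! ### Measurability and second moments along the recursion. -/

theorem stronglyMeasurable_pi_sub_const {Ω : Type*} {m : MeasurableSpace Ω} {P M : ℕ}
    {f : Fin P → Ω → Vec M} (h : ∀ p, Measurable (f p)) (c : Vec M) :
    StronglyMeasurable fun ω p => f p ω - c :=
  (measurable_pi_iff.2 fun p => (h p).sub_const c).stronglyMeasurable

namespace RandomInputs

variable {P M : ℕ} {Ω : Type*} [m0 : MeasurableSpace Ω] {Pr : Measure Ω} [IsProbabilityMeasure Pr]
  {R : RandomInputs P M Ω} {A : Fin 3 → Matrix (Fin P) (Fin P) ℝ} {q : Fin P → ℝ} {μ : ℝ}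
  {X : Type*} {L : LearningProblem P M X} {wo : Vec M} {βs σs : Fin P → ℝ} {σg ν δ κ : ℝ}

theorem LaplacianNoise.memLp (h : R.LaplacianNoise A μ Pr σg) (hσ : 0 < σg) (i : ℕ) (j : Fin 3) :
    MemLp (fun ω m p => R.g i j m p ω) 2 Pr :=
  MemLp.of_eval fun m => MemLp.of_eval fun p =>
    memLp_of_map_eq_laplaceMeasure (by positivity) (h.measurable i j m p) (h.law i j m p)

theorem LaplacianNoise.memLp_stageNoise (h : R.LaplacianNoise A μ Pr σg) (hσ : 0 < σg) (i : ℕ)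
    (j : Fin 3) : MemLp (R.stageNoise A i j) 2 Pr :=
  memLp_linearMap_comp _ (h.memLp hσ i j)

theorem LaplacianNoise.integral_netSq_stageNoise_le (h : R.LaplacianNoise A μ Pr σg)
    (hA : CombinationPolicy A q) (hσ : 0 < σg) (i : ℕ) (j : Fin 3) :
    ∫ ω, netSq (R.stageNoise A i j ω) ∂Pr ≤ P * (M * σg ^ 2) := by
  refine integral_netSq_noiseMix_le (hA.left_stochastic j) (h.memLp hσ i j) fun m p => ?_
  rw [integral_norm_sq_of_map_eq_laplaceMeasure (by positivity) (h.measurable i j m p)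
    (h.law i j m p), div_pow, Real.sq_sqrt zero_le_two]
  ring

theorem measurable_stageNoise (h : R.LaplacianNoise A μ Pr σg) (i : ℕ) (j : Fin 3) :
    Measurable (R.stageNoise A i j) :=
  measurable_pi_iff.2 fun p => by
    have h1 : ∀ m, Measurable fun ω => A j m p • R.g i j m p ω := fun m =>
      (h.measurable i j m p).const_smul (A j m p)
    have h2 : Measurable fun ω => ∑ m, A j m p • R.g i j m p ω :=
      Finset.measurable_fun_sum _ fun m _ => h1 m
    exact h2

/-- The gradient approximations are not assumed measurable, only the gradient noise is. The
induction runs on `err_succ`, where they enter through that noise alone. -/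
theorem measurable_err (hf : CenteredField (A 2 *ᵥ q) ν δ κ fun p x => gradient (L.risk p) (wo + x))
    (hA : CombinationPolicy A q) (h0 : R.SquareIntegrableStart Pr)
    (hg : R.LaplacianNoise A μ Pr σg) (hs : R.BoundedGradientNoise A μ Pr L wo βs σs) (i : ℕ) :
    Measurable (R.err A μ wo i) := by
  induction i with
  | zero => exact measurable_pi_iff.2 fun p => (h0.measurable p).sub_const wo
  | succ i ih =>
    have hmix : ∀ (B : Matrix (Fin P) (Fin P) ℝ) {v : Ω → Fin P → Vec M}, Measurable v →
        Measurable fun ω => mix B (v ω) := fun B v hv => (continuous_mix B).measurable.comp hv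
    have hfield : ∀ {v : Ω → Fin P → Vec M}, Measurable v →
        Measurable fun ω p => gradient (L.risk p) (wo + v ω p) := fun hv =>
      hf.continuous_pi.measurable.comp hv
    have hN := measurable_stageNoise hg i
    rw [show R.err A μ wo (i + 1) = _ from funext fun ω => R.err_succ μ L wo hA i ω]
    refine (((hf.continuous_driftStep A μ).measurable.comp ih).add ?_).add ?_
    · exact hmix _ (((hfield ((hmix _ ih).add (hN 1))).sub (hfield (hmix _ ih))).const_smul (-μ))
    · exact (((hmix _ (hmix _ (hN 1))).add (hmix _ (hN 0))).add (hN 2)).add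
        (hmix _ ((measurable_pi_iff.2 fun p => hs.measurable i p).const_smul (-μ)))

theorem BoundedGradientNoise.memLp_gradNoise (hs : R.BoundedGradientNoise A μ Pr L wo βs σs)
    (i : ℕ) : MemLp (fun ω p => R.gradNoise A μ L i p ω) 2 Pr :=
  MemLp.of_eval fun p => hs.memLp i p

theorem memLp_centeredNoise (hσ : 0 < σg) (hg : R.LaplacianNoise A μ Pr σg)
    (hs : R.BoundedGradientNoise A μ Pr L wo βs σs) (i : ℕ) :
    MemLp (R.centeredNoise A μ L i) 2 Pr := by
  have hN := hg.memLp_stageNoise hσ i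
  have h1 : MemLp (fun ω => mix (A 2) (mix (A 0) (R.stageNoise A i 1 ω))) 2 Pr :=
    memLp_linearMap_comp _ (memLp_linearMap_comp _ (hN 1))
  have h0 : MemLp (fun ω => mix (A 2) (R.stageNoise A i 0 ω)) 2 Pr := memLp_linearMap_comp _ (hN 0)
  have h3 : MemLp (fun ω => -μ • fun p => R.gradNoise A μ L i p ω) 2 Pr :=
    (hs.memLp_gradNoise i).const_smul (-μ)
  have h4 : MemLp (fun ω => mix (A 2) (-μ • fun p => R.gradNoise A μ L i p ω)) 2 Pr :=
    memLp_linearMap_comp _ h3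
  exact ((h1.add h0).add (hN 2)).add h4

theorem memLp_gradShift {f : Fin P → Vec M → Vec M} (hf : CenteredField (A 2 *ᵥ q) ν δ κ f)
    (hσ : 0 < σg) (hg : R.LaplacianNoise A μ Pr σg) {i : ℕ} (hu : MemLp (R.err A μ wo i) 2 Pr) :
    MemLp (R.gradShift A μ wo f i) 2 Pr := by
  have h1 := memLp_linearMap_comp (mix (A 1)) hu
  exact memLp_linearMap_comp _ (((hf.memLp_comp (h1.add (hg.memLp_stageNoise hσ i 1))).sub
    (hf.memLp_comp h1)).const_smul (-μ))

theorem memLp_err (hf : CenteredField (A 2 *ᵥ q) ν δ κ fun p x => gradient (L.risk p) (wo + x))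
    (hA : CombinationPolicy A q) (h0 : R.SquareIntegrableStart Pr) (hσ : 0 < σg)
    (hg : R.LaplacianNoise A μ Pr σg) (hs : R.BoundedGradientNoise A μ Pr L wo βs σs) (i : ℕ) :
    MemLp (R.err A μ wo i) 2 Pr := by
  induction i with
  | zero => exact MemLp.of_eval fun p => (h0.memLp p).sub (memLp_const wo)
  | succ i ih =>
    rw [show R.err A μ wo (i + 1) = _ from funext fun ω => R.err_succ μ L wo hA i ω]
    exact ((hf.memLp_driftStep A μ ih).add (memLp_gradShift hf hσ hg ih)).add
      (memLp_centeredNoise hσ hg hs i)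

theorem measurable_model (hu : ∀ i, Measurable (R.err A μ wo i)) (i : ℕ) (p : Fin P) :
    Measurable (R.model A μ i p) := by
  have h := ((measurable_pi_apply p).comp (hu i)).add_const wo
  have e : R.model A μ i p = fun ω => ((fun v : Fin P → Vec M => v p) ∘ R.err A μ wo i) ω + wo := by
    ext1 ω; simp [err]
  rw [e]
  exact h

theorem past_le (hu : ∀ i, Measurable (R.err A μ wo i)) (i : ℕ) : R.past A μ i ≤ m0 :=
  iSup_le fun j => iSup_le fun _ => iSup_le fun p => (measurable_model hu j p).comap_le

theorem stronglyMeasurable_err_past (i : ℕ) : StronglyMeasurable[R.past A μ i] (R.err A μ wo i) := by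
  have h : ∀ p, Measurable[R.past A μ i] (R.model A μ i p) := fun p =>
    measurable_iff_comap_le.2 (le_iSup_of_le i (le_iSup_of_le le_rfl (le_iSup_of_le p le_rfl)))
  exact stronglyMeasurable_pi_sub_const h wo

/-- By independence from the past, the conditional mean of each message noise is its plain mean,
which is zero. -/
theorem LaplacianNoise.condExp_stageNoise (hg : R.LaplacianNoise A μ Pr σg) (hσ : 0 < σg)
    (hu : ∀ i, Measurable (R.err A μ wo i)) (i : ℕ) (j : Fin 3) :
    Pr[R.stageNoise A i j | R.past A μ i] =ᵐ[Pr] 0 := by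
  have hL := hg.memLp hσ i j
  have hI := hL.integrable one_le_two
  refine condExp_linearMap_comp_eq_zero _ hI (condExp_pi_eq_zero hI fun m =>
    condExp_pi_eq_zero (hI.eval m) fun p => ?_)
  have hgm := hg.measurable i j m p
  have hind : Indep (MeasurableSpace.comap (R.g i j m p) inferInstance) (R.past A μ i) Pr :=
    indep_of_indep_of_le_left (hg.indep_past i)
      (le_iSup_of_le j (le_iSup_of_le m (le_iSup_of_le p le_rfl)))
  have h1 := condExp_indep_eq hgm.comap_le (past_le hu i)
    (comap_measurable (R.g i j m p)).stronglyMeasurable hind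
  refine h1.trans (Eventually.of_forall fun ω => ?_)
  exact integral_of_map_eq_laplaceMeasure (b := σg / √2) (by positivity) hgm
    ((hI.eval m).eval p) (hg.law i j m p)

theorem condExp_centeredNoise (hσ : 0 < σg) (hg : R.LaplacianNoise A μ Pr σg)
    (hs : R.BoundedGradientNoise A μ Pr L wo βs σs) (hu : ∀ i, Measurable (R.err A μ wo i)) (i : ℕ) :
    Pr[R.centeredNoise A μ L i | R.past A μ i] =ᵐ[Pr] 0 := by
  have hN := fun j => (hg.memLp_stageNoise hσ i j).integrable one_le_two
  have hN0 := hg.condExp_stageNoise hσ hu i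
  have hS := (hs.memLp_gradNoise i).integrable one_le_two
  have hS0 : Pr[fun ω p => R.gradNoise A μ L i p ω | R.past A μ i] =ᵐ[Pr] 0 :=
    condExp_pi_eq_zero hS fun p => hs.zero_mean i p
  have T : ∀ {v : Ω → Fin P → Vec M} (T : (Fin P → Vec M) →ₗ[ℝ] (Fin P → Vec M)),
      Integrable v Pr → Integrable (fun ω => T (v ω)) Pr := fun T hv =>
    (LinearMap.toContinuousLinearMap T).integrable_comp hv
  have i1 := T (mix (A 2) ∘ₗ mix (A 0)) (hN 1)
  have i0 := T (mix (A 2)) (hN 0)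
  have iS := T (mix (A 2) ∘ₗ ((-μ) • LinearMap.id)) hS
  have c1 := condExp_linearMap_comp_eq_zero (mix (A 2) ∘ₗ mix (A 0)) (hN 1) (hN0 1)
  have c0 := condExp_linearMap_comp_eq_zero (mix (A 2)) (hN 0) (hN0 0)
  have cS := condExp_linearMap_comp_eq_zero (mix (A 2) ∘ₗ ((-μ) • LinearMap.id)) hS hS0
  exact condExp_add_eq_zero ((i1.add i0).add (hN 2)) iS
    (condExp_add_eq_zero (i1.add i0) (hN 2) (condExp_add_eq_zero i1 i0 c1 c0) (hN0 2)) cS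

/-- The error of the pre-combined models. -/
def preErr (R : RandomInputs P M Ω) (A : Fin 3 → Matrix (Fin P) (Fin P) ℝ) (μ : ℝ) (wo : Vec M)
    (i : ℕ) (ω : Ω) : Fin P → Vec M :=
  mix (A 1) (R.err A μ wo i ω) + R.stageNoise A i 1 ω

theorem norm_sub_preModel (hA : CombinationPolicy A q) (i : ℕ) (ω : Ω) (p : Fin P) :
    ‖wo - R.preModel A μ i p ω‖ = ‖R.preErr A μ wo i ω p‖ := by
  rw [congrFun (R.preModel_eq μ wo hA i ω) p, sub_add_cancel_left, norm_neg]
  rfl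

theorem memLp_preErr (hσ : 0 < σg) (hg : R.LaplacianNoise A μ Pr σg) {i : ℕ}
    (hu2 : MemLp (R.err A μ wo i) 2 Pr) : MemLp (R.preErr A μ wo i) 2 Pr := by
  have h1 : MemLp (fun ω => mix (A 1) (R.err A μ wo i ω)) 2 Pr := memLp_linearMap_comp _ hu2
  exact h1.add (hg.memLp_stageNoise hσ i 1)

theorem integral_netSq_preErr_le (hA : CombinationPolicy A q) (hσ : 0 < σg)
    (hg : R.LaplacianNoise A μ Pr σg) {i : ℕ} (hu2 : MemLp (R.err A μ wo i) 2 Pr) :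
    ∫ ω, netSq (R.preErr A μ wo i ω) ∂Pr ≤
      2 * (P * ∫ ω, netSq (R.err A μ wo i ω) ∂Pr) + 2 * (P * (M * σg ^ 2)) := by
  have iE := (integrable_netSq hu2).const_mul (2 * P : ℝ)
  have iN := (integrable_netSq (hg.memLp_stageNoise hσ i 1)).const_mul (2 : ℝ)
  have h1 : ∀ ω, netSq (R.preErr A μ wo i ω) ≤ 2 * P * netSq (R.err A μ wo i ω) +
      2 * netSq (R.stageNoise A i 1 ω) := fun ω => by
    have h2 := netSq_add_le (mix (A 1) (R.err A μ wo i ω)) (R.stageNoise A i 1 ω)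
    have h3 := netSq_mix_le (hA.left_stochastic 1) (R.err A μ wo i ω)
    rw [preErr]
    linarith
  have h2 := integral_mono (integrable_netSq (memLp_preErr hσ hg hu2)) (iE.add iN) h1
  rw [integral_add' iE iN, integral_const_mul, integral_const_mul] at h2
  have h3 := hg.integral_netSq_stageNoise_le hA hσ i 1
  linarith

/-- Integration removes the conditioning on both sides of the second-moment bound; the error of one
agent is then bounded by that of the network. -/
theorem integral_norm_gradNoise_sq_le (hA : CombinationPolicy A q) (hσ : 0 < σg)
    (hg : R.LaplacianNoise A μ Pr σg) (hs : R.BoundedGradientNoise A μ Pr L wo βs σs)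
    (hu : ∀ i, Measurable (R.err A μ wo i)) {i : ℕ} (hu2 : MemLp (R.err A μ wo i) 2 Pr)
    (p : Fin P) : ∫ ω, ‖R.gradNoise A μ L i p ω‖ ^ 2 ∂Pr ≤
      βs p ^ 2 * ∫ ω, netSq (R.preErr A μ wo i ω) ∂Pr + σs p ^ 2 := by
  have hy2 := memLp_preErr hσ hg hu2
  have hint : Integrable (fun ω => ‖R.preErr A μ wo i ω p‖ ^ 2) Pr :=
    integrable_norm_sq (hy2.eval p)
  have h1 := integral_mono_ae integrable_condExp integrable_condExp (hs.second_moment i p)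
  rw [integral_condExp (past_le hu i), integral_condExp (past_le hu i)] at h1
  refine h1.trans ?_
  simp only [norm_sub_preModel hA]
  rw [integral_add (hint.const_mul _) (integrable_const _), integral_const_mul, integral_const]
  simp only [probReal_univ, smul_eq_mul, one_mul]
  refine add_le_add_left (mul_le_mul_of_nonneg_left ?_ (sq_nonneg _)) _
  exact integral_mono hint (integrable_netSq hy2) fun ω => Finset.single_le_sum
    (f := fun p => ‖R.preErr A μ wo i ω p‖ ^ 2) (fun _ _ => sq_nonneg _) (Finset.mem_univ p)

theorem integral_netSq_gradNoise_le (hA : CombinationPolicy A q) (hσ : 0 < σg)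
    (hg : R.LaplacianNoise A μ Pr σg) (hs : R.BoundedGradientNoise A μ Pr L wo βs σs)
    (hu : ∀ i, Measurable (R.err A μ wo i)) {i : ℕ} (hu2 : MemLp (R.err A μ wo i) 2 Pr) :
    ∫ ω, netSq (fun p => R.gradNoise A μ L i p ω) ∂Pr ≤
      (∑ p, βs p ^ 2) * (2 * (P * ∫ ω, netSq (R.err A μ wo i ω) ∂Pr) + 2 * (P * (M * σg ^ 2))) +
        ∑ p, σs p ^ 2 := by
  have h1 : ∫ ω, netSq (fun p => R.gradNoise A μ L i p ω) ∂Pr =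
      ∑ p, ∫ ω, ‖R.gradNoise A μ L i p ω‖ ^ 2 ∂Pr :=
    integral_finsetSum _ fun p _ => integrable_norm_sq (hs.memLp i p)
  rw [h1]
  refine (Finset.sum_le_sum fun p _ =>
    integral_norm_gradNoise_sq_le hA hσ hg hs hu hu2 p).trans ?_
  rw [Finset.sum_add_distrib, ← Finset.sum_mul]
  have : 0 ≤ ∑ p, βs p ^ 2 := Finset.sum_nonneg fun _ _ => sq_nonneg _
  exact add_le_add_left (mul_le_mul_of_nonneg_left (integral_netSq_preErr_le hA hσ hg hu2) this) _

theorem netSq_gradShift_le {f : Fin P → Vec M → Vec M} (hf : CenteredField (A 2 *ᵥ q) ν δ κ f)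
    (hA : CombinationPolicy A q) (i : ℕ) (ω : Ω) :
    netSq (R.gradShift A μ wo f i ω) ≤ P * (μ ^ 2 * (δ ^ 2 * netSq (R.stageNoise A i 1 ω))) := by
  refine (netSq_mix_le (hA.left_stochastic 2) _).trans ?_
  rw [netSq_smul, neg_sq]
  gcongr
  rw [netSq, netSq, Finset.mul_sum]
  refine Finset.sum_le_sum fun p _ => ?_
  rw [← mul_pow]
  gcongr
  simpa using hf.lipschitz p (mix (A 1) (R.err A μ wo i ω) p + R.stageNoise A i 1 ω p)
    (mix (A 1) (R.err A μ wo i ω) p)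

theorem netSq_centeredNoise_le (hA : CombinationPolicy A q) (i : ℕ) (ω : Ω) :
    netSq (R.centeredNoise A μ L i ω) ≤ 8 * (P * (P * netSq (R.stageNoise A i 1 ω))) +
      8 * (P * netSq (R.stageNoise A i 0 ω)) + 4 * netSq (R.stageNoise A i 2 ω) +
      2 * (P * (μ ^ 2 * netSq fun p => R.gradNoise A μ L i p ω)) := by
  have hm := fun j (v : Fin P → Vec M) => netSq_mix_le (hA.left_stochastic j) v
  -- The summands are split off one at a time from the right, doubling each time: `2`, `4`, then `8`
  -- for the last two.
  have h1 := netSq_add_le (mix (A 2) (mix (A 0) (R.stageNoise A i 1 ω)) +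
    mix (A 2) (R.stageNoise A i 0 ω) + R.stageNoise A i 2 ω)
    (mix (A 2) (-μ • fun p => R.gradNoise A μ L i p ω))
  have h2 := netSq_add_le (mix (A 2) (mix (A 0) (R.stageNoise A i 1 ω)) +
    mix (A 2) (R.stageNoise A i 0 ω)) (R.stageNoise A i 2 ω)
  have h3 := netSq_add_le (mix (A 2) (mix (A 0) (R.stageNoise A i 1 ω)))
    (mix (A 2) (R.stageNoise A i 0 ω))
  have h4 := (hm 2 (mix (A 0) (R.stageNoise A i 1 ω))).trans
    (mul_le_mul_of_nonneg_left (hm 0 _) (Nat.cast_nonneg P))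
  have h5 := hm 2 (R.stageNoise A i 0 ω)
  have h6 := hm 2 (-μ • fun p => R.gradNoise A μ L i p ω)
  rw [netSq_smul, neg_sq] at h6
  rw [centeredNoise]
  linarith

theorem integral_netSq_centeredNoise_le (hA : CombinationPolicy A q) (hσ : 0 < σg)
    (hg : R.LaplacianNoise A μ Pr σg) (hs : R.BoundedGradientNoise A μ Pr L wo βs σs) (i : ℕ) :
    ∫ ω, netSq (R.centeredNoise A μ L i ω) ∂Pr ≤
      (8 * (P * P) + 8 * P + 4) * (P * (M * σg ^ 2)) +
        2 * P * μ ^ 2 * ∫ ω, netSq (fun p => R.gradNoise A μ L i p ω) ∂Pr := by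
  have hN := fun j => integrable_netSq (hg.memLp_stageNoise hσ i j)
  have hS := integrable_netSq (hs.memLp_gradNoise i)
  have hNle := hg.integral_netSq_stageNoise_le hA hσ i
  have i1 := (hN 1).const_mul (8 * (P * P) : ℝ)
  have i0 := (hN 0).const_mul (8 * P : ℝ)
  have i2 := (hN 2).const_mul (4 : ℝ)
  have iS := hS.const_mul (2 * P * μ ^ 2)
  calc _ ≤ ∫ ω, (8 * (P * P) * netSq (R.stageNoise A i 1 ω) + 8 * P * netSq (R.stageNoise A i 0 ω) +
        4 * netSq (R.stageNoise A i 2 ω) +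
        2 * P * μ ^ 2 * netSq (fun p => R.gradNoise A μ L i p ω)) ∂Pr := by
        refine integral_mono (integrable_netSq (memLp_centeredNoise hσ hg hs i))
          (((i1.add i0).add i2).add iS) fun ω => ?_
        have := R.netSq_centeredNoise_le (μ := μ) (L := L) hA i ω
        simp only
        linarith
    _ = 8 * (P * P) * ∫ ω, netSq (R.stageNoise A i 1 ω) ∂Pr +
        8 * P * ∫ ω, netSq (R.stageNoise A i 0 ω) ∂Pr + 4 * ∫ ω, netSq (R.stageNoise A i 2 ω) ∂Pr +
        2 * P * μ ^ 2 * ∫ ω, netSq (fun p => R.gradNoise A μ L i p ω) ∂Pr := by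
      have e1 := integral_add' ((i1.add i0).add i2) iS
      rw [integral_add' (i1.add i0) i2, integral_add' i1 i0] at e1
      simp only [integral_const_mul] at e1
      exact e1
    _ ≤ _ := by
      have e1 := mul_le_mul_of_nonneg_left (hNle 1) (by positivity : (0 : ℝ) ≤ 8 * (P * P))
      have e0 := mul_le_mul_of_nonneg_left (hNle 0) (by positivity : (0 : ℝ) ≤ 8 * P)
      have e2 := mul_le_mul_of_nonneg_left (hNle 2) (by positivity : (0 : ℝ) ≤ 4)
      linarith

end RandomInputs

/-! ### The scalar mean-square recursion. -/

/-- `Xd`, `Y`, `Z` are the second moments of the images under `Φ` of drift, gradient shift and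
centred noise, and `S` is that of the gradient noise. Of the contraction `a * μ`, half goes to
Young's inequality and a quarter, by `hc`, to the part of `S` proportional to `x`. The large factor
`(a * μ / 2)⁻¹` is harmless because `Y` carries `μ ^ 2`. -/
theorem meanSquare_step_arith {x x' Xd Y Z S N σ a μ k₁ k₂ C₁ δ β s n : ℝ} (hx : 0 ≤ x) (ha : 0 < a)
    (hμ : 0 < μ) (hμ1 : μ < 1) (hμa : a * μ < 1) (hC₁ : 0 ≤ C₁) (hk₂ : 0 ≤ k₂)
    (hβ : 0 ≤ β) (hs : 0 ≤ s) (hn : 0 ≤ n) (hN : 0 ≤ N) (hσ : 0 ≤ σ)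
    (hc : 8 * k₂ * n ^ 2 * β * k₁ * μ ≤ a / 4)
    (hX : Xd ≤ (1 - a * μ) * x + C₁ * μ ^ 2)
    (hY : Y ≤ k₂ * (n * (μ ^ 2 * (δ ^ 2 * (N * σ)))))
    (hZ : Z ≤ k₂ * ((8 * (n * n) + 8 * n + 4) * (N * σ) + 2 * n * μ ^ 2 * S))
    (hS : S ≤ β * (2 * (n * (k₁ * x)) + 2 * (N * σ)) + s)
    (hx' : x' ≤ (1 + a * μ / 2) * Xd + (2 + (a * μ / 2)⁻¹) * Y + 2 * Z) :
    x' ≤ (1 - a / 4 * μ) * x +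
      (2 * C₁ + (2 + 2 / a) * k₂ * n * δ ^ 2 * N + 2 * k₂ * (8 * (n * n) + 8 * n + 4) * N +
        8 * k₂ * n * β * N + 4 * k₂ * n) * (μ ^ 2 * s + μ ^ 2 + σ) := by
  have haμ : 0 < a * μ := mul_pos ha hμ
  have hμ2 : μ ^ 2 ≤ 1 := by nlinarith
  have h1 : (1 + a * μ / 2) * Xd ≤ (1 - a * μ / 2) * x + 2 * C₁ * μ ^ 2 := by
    have e1 := mul_le_mul_of_nonneg_left hX (by positivity : 0 ≤ 1 + a * μ / 2)
    have e2 : 0 ≤ (a * μ) ^ 2 * x := by positivity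
    have e3 : 0 ≤ (1 - a * μ / 2) * (C₁ * μ ^ 2) := mul_nonneg (by linarith) (by positivity)
    nlinarith
  have h2 : (2 + (a * μ / 2)⁻¹) * Y ≤ (2 + 2 / a) * k₂ * n * δ ^ 2 * N * σ := by
    have e1 := mul_le_mul_of_nonneg_left hY (by positivity : 0 ≤ 2 + (a * μ / 2)⁻¹)
    have e2 : (2 + (a * μ / 2)⁻¹) * (k₂ * (n * (μ ^ 2 * (δ ^ 2 * (N * σ))))) =
        (2 * μ ^ 2 + 2 / a * μ) * (k₂ * n * δ ^ 2 * N * σ) := by field_simp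
    have e3 : 2 * μ ^ 2 + 2 / a * μ ≤ 2 + 2 / a := by
      have : 2 / a * μ ≤ 2 / a := mul_le_of_le_one_right (by positivity) hμ1.le
      linarith
    have e4 := mul_le_mul_of_nonneg_right e3 (by positivity : 0 ≤ k₂ * n * δ ^ 2 * N * σ)
    linarith
  have h3 : 2 * Z ≤ a / 4 * μ * x + 2 * k₂ * (8 * (n * n) + 8 * n + 4) * N * σ +
      8 * k₂ * n * β * N * σ + 4 * k₂ * n * (μ ^ 2 * s) := by
    have e1 := mul_le_mul_of_nonneg_left hS (by positivity : 0 ≤ 4 * k₂ * n * μ ^ 2)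
    have e2 := mul_le_mul_of_nonneg_right hc (by positivity : 0 ≤ μ * x)
    have e3 := mul_le_mul_of_nonneg_right hμ2 (by positivity : 0 ≤ 8 * k₂ * n * β * N * σ)
    linarith
  have hpos1 : 0 ≤ C₁ * (μ ^ 2 * s) := by positivity
  have hpos2 : 0 ≤ C₁ * σ := by positivity
  have hpos3 : 0 ≤ ((2 + 2 / a) * k₂ * n * δ ^ 2 * N + 2 * k₂ * (8 * (n * n) + 8 * n + 4) * N +
        8 * k₂ * n * β * N) * (μ ^ 2 * s + μ ^ 2) := by positivity
  have hpos4 : 0 ≤ 4 * k₂ * n * (μ ^ 2 + σ) := by positivity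
  linarith

theorem le_geometric_of_step {x : ℕ → ℝ} {γ c : ℝ} (hγ : 0 ≤ γ) (hγ1 : γ < 1) (hc : 0 ≤ c)
    (h : ∀ i, x (i + 1) ≤ γ * x i + c) (i : ℕ) : x i ≤ γ ^ i * x 0 + c / (1 - γ) := by
  induction i with
  | zero =>
    have : 0 ≤ c / (1 - γ) := div_nonneg hc (by linarith)
    simpa using this
  | succ i ih =>
    refine ((h i).trans (add_le_add_left (mul_le_mul_of_nonneg_left ih hγ) _)).trans_eq ?_
    have : 1 - γ ≠ 0 := by linarith
    field_simp
    ring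

theorem limsup_le_of_le_geometric {y : ℕ → ℝ} {γ c K : ℝ} (hy : ∀ i, 0 ≤ y i) (hγ : 0 ≤ γ)
    (hγ1 : γ < 1) (h : ∀ i, y i ≤ c * γ ^ i * y 0 + K) : limsup y atTop ≤ K := by
  have ht : Tendsto (fun i : ℕ => c * γ ^ i * y 0 + K) atTop (𝓝 K) := by
    simpa using (((tendsto_pow_atTop_nhds_zero_of_lt_one hγ hγ1).const_mul c).mul_const
      (y 0)).add_const K
  calc limsup y atTop ≤ limsup (fun i : ℕ => c * γ ^ i * y 0 + K) atTop :=
        limsup_le_limsup (Eventually.of_forall h)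
          -- In `ℝ` the comparison of upper limits requires a lower bound for the smaller sequence.
          (isCoboundedUnder_le_of_le atTop hy) ht.isBoundedUnder_le
    _ = K := ht.limsup_eq

theorem RandomInputs.integral_lyapunov_succ_le {P M : ℕ} {Ω : Type*} [MeasurableSpace Ω]
    {Pr : Measure Ω} [IsProbabilityMeasure Pr] {R : RandomInputs P M Ω}
    {A : Fin 3 → Matrix (Fin P) (Fin P) ℝ} {q : Fin P → ℝ} {μ : ℝ} {X : Type*}
    {L : LearningProblem P M X} {wo : Vec M} {βs σs : Fin P → ℝ} {σg ν δ κ : ℝ}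
    {H : Type*} [NormedAddCommGroup H] [InnerProductSpace ℝ H] [FiniteDimensional ℝ H]
    (Φ : (Fin P → Vec M) →ₗ[ℝ] H) {a C₁ k₁ k₂ : ℝ} (ha : 0 < a) (hμ : 0 < μ) (hμ1 : μ < 1)
    (hμa : a * μ < 1) (hC₁ : 0 ≤ C₁) (hk₂ : 0 ≤ k₂)
    (hc : 8 * k₂ * P ^ 2 * (∑ p, βs p ^ 2) * k₁ * μ ≤ a / 4)
    (hΦ₁ : ∀ u, netSq u ≤ k₁ * ‖Φ u‖ ^ 2) (hΦ₂ : ∀ u, ‖Φ u‖ ^ 2 ≤ k₂ * netSq u)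
    (hdrift : ∀ u, ‖Φ (driftStep A μ (fun p x => gradient (L.risk p) (wo + x)) u)‖ ^ 2 ≤
      (1 - a * μ) * ‖Φ u‖ ^ 2 + C₁ * μ ^ 2)
    (hf : CenteredField (A 2 *ᵥ q) ν δ κ fun p x => gradient (L.risk p) (wo + x))
    (hA : CombinationPolicy A q) (h0 : R.SquareIntegrableStart Pr) (hσ : 0 < σg)
    (hg : R.LaplacianNoise A μ Pr σg) (hs : R.BoundedGradientNoise A μ Pr L wo βs σs) (i : ℕ) :
    ∫ ω, ‖Φ (R.err A μ wo (i + 1) ω)‖ ^ 2 ∂Pr ≤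
      (1 - a / 4 * μ) * ∫ ω, ‖Φ (R.err A μ wo i ω)‖ ^ 2 ∂Pr +
      (2 * C₁ + (2 + 2 / a) * k₂ * P * δ ^ 2 * (P * M) +
        2 * k₂ * (8 * (P * P) + 8 * P + 4) * (P * M) +
        8 * k₂ * P * (∑ p, βs p ^ 2) * (P * M) + 4 * k₂ * P) *
        (μ ^ 2 * ∑ p, σs p ^ 2 + μ ^ 2 + σg ^ 2) := by
  set f : Fin P → Vec M → Vec M := fun p x => gradient (L.risk p) (wo + x) with hfdef
  have hu := measurable_err hf hA h0 hg hs
  have hu2 := memLp_err hf hA h0 hσ hg hs i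
  have : CompleteSpace H := FiniteDimensional.complete ℝ H
  have hZ2 := memLp_centeredNoise (L := L) hσ hg hs i
  have hY2 := memLp_gradShift hf hσ hg hu2
  have hX2 := hf.memLp_driftStep A μ hu2
  have hΦc : Continuous Φ := Φ.continuous_of_finiteDimensional
  have hXm : StronglyMeasurable[R.past A μ i] fun ω => Φ (driftStep A μ f (R.err A μ wo i ω)) :=
    (hΦc.comp (hf.continuous_driftStep A μ)).comp_stronglyMeasurable
      (stronglyMeasurable_err_past i)
  have hZ0 := condExp_linearMap_comp_eq_zero Φ (hZ2.integrable one_le_two)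
    (condExp_centeredNoise hσ hg hs hu i)
  -- The choice `t = a * μ / 2` keeps half of the drift contraction.
  have hmain := integral_norm_sq_add_add_le (past_le hu i) (t := a * μ / 2) (by positivity) hXm
    (memLp_linearMap_comp Φ hX2) (memLp_linearMap_comp Φ hY2) (memLp_linearMap_comp Φ hZ2) hZ0
  have hsucc : ∀ ω, Φ (R.err A μ wo (i + 1) ω) = Φ (driftStep A μ f (R.err A μ wo i ω)) +
      Φ (R.gradShift A μ wo f i ω) + Φ (R.centeredNoise A μ L i ω) := fun ω => by
    rw [R.err_succ μ L wo hA i ω, map_add, map_add]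
  simp only [← hsucc] at hmain
  have iΦ := integrable_norm_sq (memLp_linearMap_comp Φ hu2)
  have hN := hg.integral_netSq_stageNoise_le hA hσ i 1
  have hbound : ∀ {v : Ω → Fin P → Vec M}, MemLp v 2 Pr →
      ∫ ω, ‖Φ (v ω)‖ ^ 2 ∂Pr ≤ k₂ * ∫ ω, netSq (v ω) ∂Pr := fun {v} hv => by
    rw [← integral_const_mul]
    exact integral_mono (integrable_norm_sq (memLp_linearMap_comp Φ hv))
      ((integrable_netSq hv).const_mul _) fun ω => hΦ₂ (v ω)
  have hXd : ∫ ω, ‖Φ (driftStep A μ f (R.err A μ wo i ω))‖ ^ 2 ∂Pr ≤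
      (1 - a * μ) * ∫ ω, ‖Φ (R.err A μ wo i ω)‖ ^ 2 ∂Pr + C₁ * μ ^ 2 := by
    have e := integral_mono (integrable_norm_sq (memLp_linearMap_comp Φ hX2))
      ((iΦ.const_mul (1 - a * μ)).add (integrable_const (C₁ * μ ^ 2))) fun ω =>
        hdrift (R.err A μ wo i ω)
    rw [integral_add' (iΦ.const_mul _) (integrable_const _), integral_const_mul,
      integral_const] at e
    simpa using e
  have hY : ∫ ω, ‖Φ (R.gradShift A μ wo f i ω)‖ ^ 2 ∂Pr ≤
      k₂ * (P * (μ ^ 2 * (δ ^ 2 * (P * M * σg ^ 2)))) := by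
    refine (hbound hY2).trans (mul_le_mul_of_nonneg_left ?_ hk₂)
    have e := integral_mono (integrable_netSq hY2)
      ((((integrable_netSq (hg.memLp_stageNoise hσ i 1)).const_mul (δ ^ 2)).const_mul
        (μ ^ 2)).const_mul (P : ℝ)) fun ω => netSq_gradShift_le hf hA i ω
    simp only [integral_const_mul] at e
    refine e.trans ?_
    rw [mul_assoc (P : ℝ) M]
    gcongr
  have hZ : ∫ ω, ‖Φ (R.centeredNoise A μ L i ω)‖ ^ 2 ∂Pr ≤
      k₂ * ((8 * (P * P) + 8 * P + 4) * (P * M * σg ^ 2) +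
        2 * P * μ ^ 2 * ∫ ω, netSq (fun p => R.gradNoise A μ L i p ω) ∂Pr) := by
    rw [mul_assoc (P : ℝ) M]
    exact (hbound hZ2).trans (mul_le_mul_of_nonneg_left
      (integral_netSq_centeredNoise_le hA hσ hg hs i) hk₂)
  have hE : ∫ ω, netSq (R.err A μ wo i ω) ∂Pr ≤ k₁ * ∫ ω, ‖Φ (R.err A μ wo i ω)‖ ^ 2 ∂Pr := by
    rw [← integral_const_mul]
    exact integral_mono (integrable_netSq hu2) (iΦ.const_mul _) fun ω => hΦ₁ _
  have hβ : 0 ≤ ∑ p, βs p ^ 2 := Finset.sum_nonneg fun _ _ => sq_nonneg _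
  have hS : ∫ ω, netSq (fun p => R.gradNoise A μ L i p ω) ∂Pr ≤
      (∑ p, βs p ^ 2) * (2 * (P * (k₁ * ∫ ω, ‖Φ (R.err A μ wo i ω)‖ ^ 2 ∂Pr)) +
        2 * (P * M * σg ^ 2)) + ∑ p, σs p ^ 2 := by
    refine (integral_netSq_gradNoise_le hA hσ hg hs hu hu2).trans ?_
    rw [mul_assoc (P : ℝ) M]
    gcongr
  exact meanSquare_step_arith (integral_nonneg fun _ => sq_nonneg _) ha hμ hμ1 hμa hC₁ hk₂ hβ
    (Finset.sum_nonneg fun _ _ => sq_nonneg _) (Nat.cast_nonneg P) (by positivity) (sq_nonneg σg)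
    hc hXd hY hZ hS hmain

end

/-! ### Choice of constants and conclusion. -/

theorem theorem1 {P M : ℕ} (A : Fin 3 → Matrix (Fin P) (Fin P) ℝ) (q : Fin P → ℝ)
    (hA : CombinationPolicy A q) (ν δ ξ : ℝ) (hν : 0 < ν) (hδ : 0 < δ) (hξ : 0 ≤ ξ)
    (βs : Fin P → ℝ) :
    ∃ μ₀ C : ℝ, 0 < μ₀ ∧ 0 ≤ C ∧ ∀ μ : ℝ, 0 < μ → μ < μ₀ → ∃ γ : ℝ, 0 ≤ γ ∧ γ < 1 ∧
      ∀ (X : Type*) (L : LearningProblem P M X) (wo : Vec M) (wloc : Fin P → Vec M),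
        L.ConvexSmooth ν δ → L.ModelDrift ξ wo wloc →
        IsMinOn (L.weightedAggregate (A 2 *ᵥ q)) Set.univ wo →
      ∀ (Ω : Type*) [MeasurableSpace Ω] (Pr : Measure Ω) [IsProbabilityMeasure Pr]
        (R : RandomInputs P M Ω) (σs : Fin P → ℝ) (σg : ℝ), 0 < σg →
        R.SquareIntegrableStart Pr → R.LaplacianNoise A μ Pr σg →
        R.BoundedGradientNoise A μ Pr L wo βs σs →
        (∀ i, Integrable (R.errSq A μ wo i) Pr) ∧
        (∀ i, (∫ ω, R.errSq A μ wo i ω ∂Pr) ≤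
          C * γ ^ i * (∫ ω, R.errSq A μ wo 0 ω ∂Pr) +
            (C * μ * (∑ p, σs p ^ 2) + C * μ + (C * μ⁻¹ + C * μ) * σg ^ 2)) ∧
        limsup (fun i => ∫ ω, R.errSq A μ wo i ω ∂Pr) atTop ≤
          C * μ * (∑ p, σs p ^ 2) + C * μ + (C * μ⁻¹ + C * μ) * σg ^ 2 := by
  obtain ⟨H, _, _, _, Φ, a, μ₁, C₁, k₁, k₂, ha, hμ₁, hC₁, hk₁, hk₂, hΦ₁, hΦ₂, hdrift⟩ :=
    exists_drift_lyapunov hA hν hδ (δ * ξ) (Vec M)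
  have hβ : 0 ≤ ∑ p, βs p ^ 2 := Finset.sum_nonneg fun _ _ => sq_nonneg _
  set b : ℝ := 8 * k₂ * P ^ 2 * (∑ p, βs p ^ 2) * k₁ with hb
  have hb0 : 0 ≤ b := by positivity
  set D : ℝ := 2 * C₁ + (2 + 2 / a) * k₂ * P * δ ^ 2 * (P * M) +
        2 * k₂ * (8 * (P * P) + 8 * P + 4) * (P * M) +
        8 * k₂ * P * (∑ p, βs p ^ 2) * (P * M) + 4 * k₂ * P with hD
  have hD0 : 0 ≤ D := by positivity
  -- The first summand converts between `‖Φ u‖ ^ 2` and the squared error in the transient; the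
  -- second comes from dividing the floor by `a / 4 * μ`.
  set C : ℝ := k₁ * k₂ + 4 * k₁ * D / a with hC
  have hC0 : 0 ≤ C := by positivity
  -- The bound `1 / a` gives `a * μ < 1`; the last one makes the feedback of the gradient noise at
  -- most `a / 4`.
  refine ⟨min (min μ₁ 1) (min (1 / a) (a / 4 / (b + 1))), C, by positivity, hC0,
    fun μ hμ hμ0 => ?_⟩
  simp only [lt_min_iff] at hμ0
  obtain ⟨⟨hμμ₁, hμ1⟩, hμa, hμb⟩ := hμ0
  rw [lt_div_iff₀ ha, mul_comm] at hμa
  rw [lt_div_iff₀ (by positivity)] at hμb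
  have haμ : 0 < a * μ := mul_pos ha hμ
  have hγ0 : 0 ≤ 1 - a / 4 * μ := by linarith
  have hγ1 : 1 - a / 4 * μ < 1 := by linarith
  refine ⟨1 - a / 4 * μ, hγ0, hγ1, fun X L wo wloc hL hd hr Ω _ Pr _ R σs σg hσ h0 hg hs => ?_⟩
  have hf := hL.centeredField hδ.le hd hr
  have hu2 := RandomInputs.memLp_err hf hA h0 hσ hg hs
  have hE : ∀ i ω, R.errSq A μ wo i ω = netSq (R.err A μ wo i ω) := fun i ω =>
    Finset.sum_congr rfl fun p _ => by rw [norm_sub_rev]; rfl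
  have hint : ∀ i, Integrable (R.errSq A μ wo i) Pr := fun i => by
    rw [show R.errSq A μ wo i = _ from funext (hE i)]
    exact integrable_netSq (hu2 i)
  have hstep := fun i => R.integral_lyapunov_succ_le Φ ha hμ hμ1 hμa hC₁ hk₂
    (by rw [← hb]; linarith) hΦ₁ hΦ₂ (hdrift μ hμ hμμ₁ _ hf) hf hA h0 hσ hg hs i
  set W : ℝ := μ ^ 2 * ∑ p, σs p ^ 2 + μ ^ 2 + σg ^ 2 with hW
  have hσs : 0 ≤ ∑ p, σs p ^ 2 := Finset.sum_nonneg fun _ _ => sq_nonneg _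
  have hW0 : 0 ≤ W := by positivity
  have hbound : ∀ i, (∫ ω, R.errSq A μ wo i ω ∂Pr) ≤
      C * (1 - a / 4 * μ) ^ i * (∫ ω, R.errSq A μ wo 0 ω ∂Pr) +
        (C * μ * (∑ p, σs p ^ 2) + C * μ + (C * μ⁻¹ + C * μ) * σg ^ 2) := fun i => by
    have hgeo := le_geometric_of_step
      (x := fun i => ∫ ω, ‖Φ (R.err A μ wo i ω)‖ ^ 2 ∂Pr) hγ0 hγ1 (mul_nonneg hD0 hW0) hstep i
    have iΦ := fun i => integrable_norm_sq (memLp_linearMap_comp Φ (hu2 i))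
    simp only [hE]
    have e1 : ∫ ω, netSq (R.err A μ wo i ω) ∂Pr ≤
        k₁ * ∫ ω, ‖Φ (R.err A μ wo i ω)‖ ^ 2 ∂Pr := by
      rw [← integral_const_mul]
      exact integral_mono (integrable_netSq (hu2 i)) ((iΦ i).const_mul _) fun ω => hΦ₁ _
    have e2 : ∫ ω, ‖Φ (R.err A μ wo 0 ω)‖ ^ 2 ∂Pr ≤
        k₂ * ∫ ω, netSq (R.err A μ wo 0 ω) ∂Pr := by
      rw [← integral_const_mul]
      exact integral_mono (iΦ 0) ((integrable_netSq (hu2 0)).const_mul _) fun ω => hΦ₂ _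
    have e3 : 0 ≤ ∫ ω, netSq (R.err A μ wo 0 ω) ∂Pr := integral_nonneg fun _ => netSq_nonneg _
    have hp : 0 ≤ (1 - a / 4 * μ) ^ i := pow_nonneg hγ0 i
    have hK : 0 ≤ 4 * k₁ * D / a := by positivity
    -- Division by `μ` turns the floor `W` into the three rates `μ`, `μ` and `μ⁻¹` of the limiting
    -- error.
    have e4 : k₁ * (D * W / (1 - (1 - a / 4 * μ))) =
        4 * k₁ * D / a * (μ * (∑ p, σs p ^ 2) + μ + μ⁻¹ * σg ^ 2) := by
      rw [hW]
      field_simp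
      ring
    have e5 : k₁ * ((1 - a / 4 * μ) ^ i * ∫ ω, ‖Φ (R.err A μ wo 0 ω)‖ ^ 2 ∂Pr) ≤
        C * (1 - a / 4 * μ) ^ i * ∫ ω, netSq (R.err A μ wo 0 ω) ∂Pr := by
      calc _ ≤ k₁ * ((1 - a / 4 * μ) ^ i * (k₂ * ∫ ω, netSq (R.err A μ wo 0 ω) ∂Pr)) := by gcongr
        _ = k₁ * k₂ * ((1 - a / 4 * μ) ^ i * ∫ ω, netSq (R.err A μ wo 0 ω) ∂Pr) := by ring
        _ ≤ C * ((1 - a / 4 * μ) ^ i * ∫ ω, netSq (R.err A μ wo 0 ω) ∂Pr) := by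
          gcongr
          linarith
        _ = _ := by ring
    have e6 : 4 * k₁ * D / a * (μ * (∑ p, σs p ^ 2) + μ + μ⁻¹ * σg ^ 2) ≤
        C * (μ * (∑ p, σs p ^ 2) + μ + μ⁻¹ * σg ^ 2) := by
      have : 0 ≤ k₁ * k₂ := mul_nonneg hk₁ hk₂
      gcongr
      linarith
    have e7 : 0 ≤ C * μ * σg ^ 2 := by positivity
    have e8 := mul_le_mul_of_nonneg_left hgeo hk₁
    rw [mul_add, e4] at e8
    linarith
  exact ⟨hint, hbound, limsup_le_of_le_geometric (fun i => integral_nonneg fun ω =>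
    Finset.sum_nonneg fun _ _ => sq_nonneg _) hγ0 hγ1 hbound⟩
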